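/- Work with problems, that is, partial multifunctions on $\mathbb{N}^{\mathbb{N}}$, where numbers, finite structures, colourings, sets and sequences are coded in the standard way. A problem $g$ is Weihrauch reducible to $f$, written $g\le_{\mathrm W} f$, if there are computable partial functionals $H,K$ on $\mathbb{N}^{\mathbb{N}}$ such that $K\langle FH,\mathrm{id}\rangle$ realizes $g$ whenever $F$ realizes $f$; $f\equiv_{\mathrm W} g$ means $f\le_{\mathrm W} g$ and $g\le_{\mathrm W} f$. Further, $f\times g$ is the parallel product (solve an instance of $f$ and an instance of $g$), and $f^*$ is the finite parallelization (given $n$ and $n$ instances of $f$, solve all of them). * $\mathsf{TC}_{\mathbb N}$: given an enumeration of an arbitrary set $A\subseteq\mathbb{N}$, output some $n\notin A$ if $A\neq\mathbb{N}$, and any $n\in\mathbb{N}$ if $A=\mathbb{N}$. * $\mathsf{LPO}'$: given a sequence $\langle p_0,p_1,\dots\rangle$ of infinite binary strings such that $p(i)=\lim_{s\to\infty}p_i(s)$ exists for every $i$, output $0$ if $p=0^{\mathbb N}$ and $1$ otherwise. Let $[\mathbb{N}]^2=\{(x,y)\in\mathbb{N}^2: x<y\}$. For a poset $P$, a colouring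 $c:[\mathbb{N}]^2\to P$ is right-ordered if $c(x,y)\preceq_P c(x,y')$ whenever $x<y\le y'$; for a semigroup $S$, a colouring $c:[\mathbb{N}]^2\to S$ is additive if $c(x,z)=c(x,y)\cdot c(y,z)$ whenever $x<y<z$. A set $X\subseteq\mathbb{N}$ is $c$-homogeneous if $c$ is constant on the pairs $x<y$ from $X$; this constant value is its colour. * $\mathsf{ORT}_{\mathbb N}$: given a finite poset $P$ and a right-ordered colouring $c:[\mathbb{N}]^2\to P$, output an infinite $c$-homogeneous set. $\mathsf{ART}_{\mathbb N}$: given a finite semigroup $S$ and an additive colouring $c:[\mathbb{N}]^2\to S$, output an infinite $c$-homogeneous set. * $\mathsf{cORT}_{\mathbb N}$ and $\mathsf{cART}_{\mathbb N}$: same instances as $\mathsf{ORT}_{\mathbb N}$ and $\mathsf{ART}_{\mathbb N}$ respectively; output a colour that is the colour of some infinite $c$-homogeneous set. * $\mathsf{iORT}_{\mathbb N}$ and $\mathsf{iART}_{\mathbb N}$: same instances as $\mathsf{ORT}_{\mathbb N}$ and $\mathsf{ART}_{\mathbb N}$ respectively; output some $n_0\in\mathbb{N}$ such that there is an infinite $c$-homogeneous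 set with two elements $\le n_0$. **Theorem.** The following equivalences hold: 1. $\mathsf{ORT}_{\mathbb N}\equiv_{\mathrm W}\mathsf{ART}_{\mathbb N}\equiv_{\mathrm W}\mathsf{TC}_{\mathbb N}^*\times(\mathsf{LPO}')^*$; 2. $\mathsf{cORT}_{\mathbb N}\equiv_{\mathrm W}\mathsf{cART}_{\mathbb N}\equiv_{\mathrm W}(\mathsf{LPO}')^*$; 3. $\mathsf{iORT}_{\mathbb N}\equiv_{\mathrm W}\mathsf{iART}_{\mathbb N}\equiv_{\mathrm W}\mathsf{TC}_{\mathbb N}^*$. -/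

import Mathlib

open Filter

namespace Weihrauch

/-! ### Computable functionals on Baire space -/

/-- Baire space. Its elements are the names of the objects that are computed with. -/
abbrev Baire : Type := ℕ → ℕ

/-- The initial segment of length `k` of `p`. -/
def initSeg (p : Baire) (k : ℕ) : List ℕ := (List.range k).map p

/-- A partial functional `F` on Baire space is computable: there is one algorithm `φ` which, for
every `p` in the domain of `F` and every `n`, is run on longer and longer initial segments of `p`
until it gives an answer for the first time, and that answer is the `n`-th value of `F p`.
Nothing is required of `φ` on names outside the domain of `F`. -/
def ComputableFunctional (F : Baire →. Baire) : Prop :=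
  ∃ φ : List ℕ → ℕ → Option ℕ, Computable₂ φ ∧
    ∀ p : Baire, ∀ q ∈ F p, ∀ n : ℕ, ∃ k : ℕ,
      φ (initSeg p k) n = some (q n) ∧ ∀ j < k, φ (initSeg p j) n = none

/-- The pair `⟨p, q⟩` of two elements of Baire space. -/
def pair (p q : Baire) : Baire := fun n => if n % 2 = 0 then p (n / 2) else q (n / 2)

/-- First component of a pair. -/
def fst (p : Baire) : Baire := fun n => p (2 * n)

/-- Second component of a pair. -/
def snd (p : Baire) : Baire := fun n => p (2 * n + 1)

theorem fst_pair (p q : Baire) : fst (pair p q) = p := by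
  funext n; simp [fst, pair]

theorem snd_pair (p q : Baire) : snd (pair p q) = q := by
  funext n
  have h : (2 * n + 1) / 2 = n := by omega
  simp [snd, pair, Nat.add_mod, h]

/-- `n` followed by `p`. -/
def cons (n : ℕ) (p : Baire) : Baire
  | 0 => n
  | i + 1 => p i

/-- `p` without its first value. -/
def tail (p : Baire) : Baire := fun n => p (n + 1)

/-- The `i`-th element of the sequence `⟨p₀, p₁, …⟩` of elements of Baire space coded by `p`. -/
def comp (p : Baire) (i : ℕ) : Baire := fun s => p (Nat.pair i s)

/-! ### Problems and Weihrauch reducibility -/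

/-- A problem, that is, a partial multifunction on Baire space: every instance (element of its
domain `dom`) has a nonempty set `sol` of solutions. -/
structure Problem where
  dom : Set Baire
  sol : Baire → Set Baire
  nonempty : ∀ p ∈ dom, (sol p).Nonempty

/-- The partial function `F` is a realizer of the problem `f`. -/
def IsRealizer (F : Baire →. Baire) (f : Problem) : Prop :=
  ∀ p ∈ f.dom, ∃ q ∈ F p, q ∈ f.sol p

/-- The partial function `K ⟨F H, id⟩`. -/
def compose (K F H : Baire →. Baire) : Baire →. Baire := fun p =>
  (H p).bind fun x => (F x).bind fun y => K (pair y p)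

/-- `g` is Weihrauch reducible to `f`. -/
def Reducible (g f : Problem) : Prop :=
  ∃ H K : Baire →. Baire, ComputableFunctional H ∧ ComputableFunctional K ∧
    ∀ F : Baire →. Baire, IsRealizer F f → IsRealizer (compose K F H) g

/-- Weihrauch equivalence. -/
def Equivalent (f g : Problem) : Prop := Reducible f g ∧ Reducible g f

/-! ### Operations on problems -/

/-- The parallel product `f × g`. -/
def Problem.prod (f g : Problem) : Problem where
  dom := {p | fst p ∈ f.dom ∧ snd p ∈ g.dom}
  sol p := {q | fst q ∈ f.sol (fst p) ∧ snd q ∈ g.sol (snd p)}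
  nonempty := by
    rintro p ⟨h1, h2⟩
    obtain ⟨a, ha⟩ := f.nonempty _ h1
    obtain ⟨b, hb⟩ := g.nonempty _ h2
    exact ⟨pair a b, by simpa [fst_pair] using ha, by simpa [snd_pair] using hb⟩

/-- The finite parallelization `f^*`: an instance is a number `n` followed by (a code of) `n`
instances of `f`, and a solution is `n` followed by solutions of these `n` instances. -/
def Problem.star (f : Problem) : Problem where
  dom := {p | ∀ i < p 0, comp (tail p) i ∈ f.dom}
  sol p := {q | q 0 = p 0 ∧ ∀ i < p 0, comp (tail q) i ∈ f.sol (comp (tail p) i)}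
  nonempty := by
    intro p hp
    have h : ∀ i, ∃ q, i < p 0 → q ∈ f.sol (comp (tail p) i) := by
      intro i
      by_cases hi : i < p 0
      · obtain ⟨q, hq⟩ := f.nonempty _ (hp i hi)
        exact ⟨q, fun _ => hq⟩
      · exact ⟨0, fun h => absurd h hi⟩
    choose q hq using h
    refine ⟨cons (p 0) fun m => q m.unpair.1 m.unpair.2, rfl, fun i hi => ?_⟩
    have e : comp (tail (cons (p 0) fun m => q m.unpair.1 m.unpair.2)) i = q i := by
      funext s; simp [comp, tail, cons]
    rw [e]
    exact hq i hi

/-! ### The benchmark problems. A natural number `n` is named by any `q` with `q 0 = n`. -/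

/-- The subset of `ℕ` enumerated by `e`: the value `m + 1` puts `m` into the set and the value `0`
puts nothing in, so that the empty set has enumerations as well. -/
def enumerated (e : Baire) : Set ℕ := {m | ∃ s, e s = m + 1}

/-- `TC_ℕ`: given an enumeration of any set `A ⊆ ℕ`, find a number outside of `A`; any number is
a solution if `A = ℕ`. -/
def TC : Problem where
  dom := Set.univ
  sol e := {q | q 0 ∉ enumerated e ∨ enumerated e = Set.univ}
  nonempty := by
    intro e _
    by_cases h : enumerated e = Set.univ
    · exact ⟨0, Or.inr h⟩
    · obtain ⟨m, hm⟩ := (Set.ne_univ_iff_exists_notMem _).1 h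
      exact ⟨fun _ => m, Or.inl hm⟩

/-- `LPO`: given an infinite binary string `p`, answer `0` if `p = 0^ℕ` and `1` otherwise. -/
def LPO : Problem where
  dom := {p | ∀ n, p n ≤ 1}
  sol p := {q | (q 0 = 0 ∧ ∀ n, p n = 0) ∨ (q 0 = 1 ∧ ∃ n, p n ≠ 0)}
  nonempty := by
    intro p _
    by_cases h : ∀ n, p n = 0
    · exact ⟨fun _ => 0, Or.inl ⟨rfl, h⟩⟩
    · exact ⟨fun _ => 1, Or.inr ⟨rfl, not_forall.1 h⟩⟩

/-- `r i = lim_s p_i(s)` for every `i`, where `p` codes the sequence `⟨p₀, p₁, …⟩`. -/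
def IsLimit (p r : Baire) : Prop := ∀ i, ∀ᶠ s in atTop, comp p i s = r i

/-- `LPO'`, the jump of `LPO`: given a sequence `⟨p₀, p₁, …⟩` of infinite binary strings such that
`r(i) = lim_s p_i(s)` exists for every `i`, answer `LPO(r)`. -/
def LPOJump : Problem where
  dom := {p | (∀ n, p n ≤ 1) ∧ ∃ r, IsLimit p r}
  sol p := {q | ∃ r, IsLimit p r ∧ q ∈ LPO.sol r}
  nonempty := by
    rintro p ⟨hp, r, hr⟩
    have h : r ∈ LPO.dom := by
      intro i
      obtain ⟨s, hs⟩ := (hr i).exists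
      rw [← hs]
      exact hp _
    obtain ⟨q, hq⟩ := LPO.nonempty r h
    exact ⟨q, r, hr, hq⟩

/-! ### Colourings of pairs of natural numbers

A colouring of `[ℕ]²` is given by a function `c` of two variables, of which only the values
`c x y` with `x < y` are relevant. -/

/-- The colouring `c : [ℕ]² → P` is right-ordered. -/
def RightOrdered {P : Type*} [PartialOrder P] (c : ℕ → ℕ → P) : Prop :=
  ∀ x y y', x < y → y ≤ y' → c x y ≤ c x y'

/-- The colouring `c : [ℕ]² → S` is additive. -/
def Additive {S : Type*} [Semigroup S] (c : ℕ → ℕ → S) : Prop :=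
  ∀ x y z, x < y → y < z → c x z = c x y * c y z

/-- `X` is `c`-homogeneous with colour `a`. -/
def HomogeneousWith {C : Type*} (c : ℕ → ℕ → C) (a : C) (X : Set ℕ) : Prop :=
  ∀ x ∈ X, ∀ y ∈ X, x < y → c x y = a

/-- `X` is `c`-homogeneous. -/
def Homogeneous {C : Type*} (c : ℕ → ℕ → C) (X : Set ℕ) : Prop := ∃ a, HomogeneousWith c a X

theorem exists_eventually_eq {C : Type*} [Finite C] (U : Ultrafilter ℕ) (f : ℕ → C) :
    ∃ a, ∀ᶠ x in (U : Filter ℕ), f x = a := by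
  have h : (Set.univ : Set C) ∈ U.map f := Filter.univ_mem
  obtain ⟨a, -, ha⟩ :=
    (Ultrafilter.finite_biUnion_mem_iff (f := U.map f) (s := fun a : C => ({a} : Set C))
      (Set.finite_univ (α := C))).1 (by rw [Set.biUnion_of_singleton]; exact h)
  exact ⟨a, ha⟩

/-- Infinite Ramsey theorem for pairs, which shows that the problems below have solutions. -/
theorem exists_homogeneous {C : Type*} [Finite C] (c : ℕ → ℕ → C) :
    ∃ a, ∃ X : Set ℕ, X.Infinite ∧ HomogeneousWith c a X := by
  choose l hl using fun x => exists_eventually_eq (hyperfilter ℕ) (c x)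
  obtain ⟨a, ha⟩ := exists_eventually_eq (hyperfilter ℕ) l
  obtain ⟨f, -, hf⟩ := exists_seq_of_forall_finset_exists (fun x => l x = a)
    (fun x y => x < y ∧ c x y = a) (by
      intro s hs
      have h1 : ∀ᶠ y in (hyperfilter ℕ : Filter ℕ), ∀ x ∈ s, x < y ∧ c x y = a := by
        rw [Filter.eventually_all_finset]
        intro x hx
        have h2 : ∀ᶠ y in (hyperfilter ℕ : Filter ℕ), x < y :=
          Nat.hyperfilter_le_atTop (eventually_gt_atTop x)
        filter_upwards [h2, hl x] with y hy hy'
        exact ⟨hy, hy'.trans (hs x hx)⟩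
      exact (ha.and h1).exists)
  have hmono : StrictMono f := fun m n h => (hf m n h).1
  refine ⟨a, Set.range f, Set.infinite_range_of_injective hmono.injective, ?_⟩
  rintro _ ⟨m, rfl⟩ _ ⟨n, rfl⟩ h
  exact (hf m n (hmono.lt_iff_lt.1 h)).2

/-! ### Instances: a finite structure together with a colouring

The name `p` starts with the number `size p` of elements of the structure, whose underlying set is
`{0, …, size p - 1}`. After that, the odd positions hold the table of the order relation or of the
multiplication, and the even positions hold the colours of the pairs. -/

def size (p : Baire) : ℕ := p 0

def table (p : Baire) (i j : ℕ) : ℕ := p (2 * Nat.pair i j + 1)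

def colour (p : Baire) (x y : ℕ) : ℕ := p (2 * Nat.pair x y + 2)

/-- `p` names the colouring `c`. -/
def NamesColouring (p : Baire) (c : ℕ → ℕ → Fin (size p)) : Prop :=
  ∀ x y, x < y → colour p x y = c x y

/-- `p` names a finite poset `P` and a right-ordered colouring `c : [ℕ]² → P`. -/
def IsOrderedInstance (p : Baire) : Prop :=
  ∃ (P : PartialOrder (Fin (size p))) (c : ℕ → ℕ → Fin (size p)),
    (∀ i j : Fin (size p), P.le i j ↔ table p i j ≠ 0) ∧ NamesColouring p c ∧ @RightOrdered _ P c

/-- `p` names a finite semigroup `S` and an additive colouring `c : [ℕ]² → S`. -/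
def IsAdditiveInstance (p : Baire) : Prop :=
  ∃ (S : Semigroup (Fin (size p))) (c : ℕ → ℕ → Fin (size p)),
    (∀ i j : Fin (size p), table p i j = S.mul i j) ∧ NamesColouring p c ∧ @Additive _ S c

theorem exists_homogeneous_colour {p : Baire} {c : ℕ → ℕ → Fin (size p)}
    (h : NamesColouring p c) :
    ∃ a, ∃ X : Set ℕ, X.Infinite ∧ HomogeneousWith (colour p) a X := by
  obtain ⟨a, X, hX, hc⟩ := exists_homogeneous c
  exact ⟨a, X, hX, fun x hx y hy hxy => by rw [h x y hxy, hc x hx y hy hxy]⟩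

/-- Given an instance, find (the characteristic function of) an infinite homogeneous set. -/
noncomputable def findSet (inst : Baire → Prop)
    (h : ∀ p, inst p → ∃ c, NamesColouring p c) : Problem where
  dom := {p | inst p}
  sol p := {q | ∃ X : Set ℕ, X.Infinite ∧ Homogeneous (colour p) X ∧ q = X.indicator 1}
  nonempty := by
    intro p hp
    obtain ⟨c, hc⟩ := h p hp
    obtain ⟨a, X, hX, hX'⟩ := exists_homogeneous_colour hc
    exact ⟨_, X, hX, ⟨a, hX'⟩, rfl⟩

/-- Given an instance, find the colour of some infinite homogeneous set. -/
def findColour (inst : Baire → Prop) (h : ∀ p, inst p → ∃ c, NamesColouring p c) : Problem where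
  dom := {p | inst p}
  sol p := {q | ∃ X : Set ℕ, X.Infinite ∧ HomogeneousWith (colour p) (q 0) X}
  nonempty := by
    intro p hp
    obtain ⟨c, hc⟩ := h p hp
    obtain ⟨a, X, hX, hX'⟩ := exists_homogeneous_colour hc
    exact ⟨fun _ => a, X, hX, hX'⟩

/-- Given an instance, find some `n₀` such that there is an infinite homogeneous set with two
elements `≤ n₀`. -/
def findBound (inst : Baire → Prop) (h : ∀ p, inst p → ∃ c, NamesColouring p c) : Problem where
  dom := {p | inst p}
  sol p := {q | ∃ X : Set ℕ, X.Infinite ∧ Homogeneous (colour p) X ∧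
    ∃ x ∈ X, ∃ y ∈ X, x < y ∧ y ≤ q 0}
  nonempty := by
    intro p hp
    obtain ⟨c, hc⟩ := h p hp
    obtain ⟨a, X, hX, hX'⟩ := exists_homogeneous_colour hc
    obtain ⟨x, hx⟩ := hX.nonempty
    obtain ⟨y, hy, hxy⟩ := hX.exists_gt x
    exact ⟨fun _ => y, X, hX, ⟨a, hX'⟩, x, hx, y, hy, hxy, le_rfl⟩

theorem IsOrderedInstance.names {p : Baire} (h : IsOrderedInstance p) :
    ∃ c, NamesColouring p c :=
  let ⟨_, c, _, hc, _⟩ := h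
  ⟨c, hc⟩

theorem IsAdditiveInstance.names {p : Baire} (h : IsAdditiveInstance p) :
    ∃ c, NamesColouring p c :=
  let ⟨_, c, _, hc, _⟩ := h
  ⟨c, hc⟩

/-- `ORT_ℕ` -/
noncomputable def ORT : Problem := findSet IsOrderedInstance fun _ => IsOrderedInstance.names

/-- `ART_ℕ` -/
noncomputable def ART : Problem := findSet IsAdditiveInstance fun _ => IsAdditiveInstance.names

/-- `cORT_ℕ` -/
def cORT : Problem := findColour IsOrderedInstance fun _ => IsOrderedInstance.names

/-- `cART_ℕ` -/
def cART : Problem := findColour IsAdditiveInstance fun _ => IsAdditiveInstance.names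

/-- `iORT_ℕ` -/
def iORT : Problem := findBound IsOrderedInstance fun _ => IsOrderedInstance.names

/-- `iART_ℕ` -/
def iART : Problem := findBound IsAdditiveInstance fun _ => IsAdditiveInstance.names

end Weihrauch

/-!
Every one of the three lines is a cycle of three reductions: from the additive Ramsey problem to the
ordered one, from there to the benchmark, and from the benchmark back to the additive problem.

*Additive to ordered* (`ART_le_ORT`, `cART_le_cORT`, `iART_le_iORT`). For an additive colouring `c`
let `c'(x, y)` be the set of all pairs `(c(x, a), c(a, b))` with `x < a < b ≤ y`. It increases with
`y`, so `c'` is right-ordered for inclusion. Let `X` be infinite and homogeneous for `c'` with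
colour `F`. Ramsey's theorem for `c` inside `X` provides an idempotent `e` with `(e, e) ∈ F` which
is a right multiple of all first components of pairs in `F` (`exists_isLeastColour`), and these
properties of `e` can be read off from `F`. Conversely, they imply that from every `x ∈ X` there are
infinitely many `y` with `c(x, y) = e` such that `c(y, z) = e` for some `z`
(`IsLeastColour.exists_gt`): this is a permutation argument in the right ideal of `e`. For such `y`
and `y' > z` one has `c(y, y') = e * c(z, y')`, hence
`c(y, y') = e * c(y, y') = c(x, y) * c(y, y') = c(x, y') = e`. So a greedy choice of such `y` yields
a homogeneous set, and `{x, y}` can be made part of it.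

*Ordered to benchmark* (`ORT_le_prod`, `cORT_le_LPOJump`, `iORT_le_TC`). Let `a` be maximal among
the colours taken by pairs with arbitrarily large first element. Beyond some `x₀` no colour above
`a` occurs, so that `c(y, z) = a` with `y ≥ x₀` implies `c(y, y') = a` for all `y' ≥ z`, and a greedy
choice gives a homogeneous set. For each colour, `LPO'` tells whether it occurs arbitrarily late,
which determines `a`, and `TC_ℕ` supplies a suitable `x₀` together with the beginning of a
homogeneous set. Without `LPO'` the right `a` is unknown, but for the bounds it suffices to add up
the answers for all colours.

*Benchmark to additive* (`prod_le_ART`, `LPOJump_le_cART`, `TC_le_iART`). An instance of either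
benchmark problem asks about numbers that can be refuted: a number is refuted for `TC_ℕ` by being
enumerated, and `⟨i, v⟩`, read as `∀ s ≥ v, p_i(s) = 1`, is refuted by a counterexample `s`. A
running guess goes through the numbers and moves on whenever its current value is refuted, so it
changes infinitely often exactly when all numbers are refuted (`AllRefuted`). Finitely many such
guesses define an additive colouring by sets, with union as multiplication: `c(x, y)` is the set of
the guesses that change between the stages `x` and `y`. The colour of an infinite homogeneous set is
the set of the guesses that change infinitely often, and beyond its least element the other guesses
are final.

Computability is treated through `OracleComputable`, a notion of computability relative to an oracle
that has the usual closure properties, and the reductions are given by total functions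
(`ReducibleVia`).
-/

namespace Weihrauch

/-! ### Computability relative to an oracle -/

/-- The function `f` is computable in its second argument, uniformly in the oracle `p ∈ D`: one
algorithm `φ`, run on an initial segment of `p`, never gives a wrong answer, and gives an answer on
all sufficiently long initial segments. -/
def OracleComputable {α σ : Type*} [Primcodable α] [Primcodable σ] (D : Set Baire)
    (f : Baire → α → σ) : Prop :=
  ∃ φ : List ℕ → α → Option σ, Computable₂ φ ∧ ∀ p ∈ D, ∀ a,
    (∀ k b, φ (initSeg p k) a = some b → b = f p a) ∧
      ∀ᶠ k in atTop, φ (initSeg p k) a = some (f p a)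

/-- The relation `P` is decidable, uniformly in the oracle `p ∈ D`. -/
def OracleDecidable {α : Type*} [Primcodable α] (D : Set Baire) (P : Baire → α → Prop) : Prop :=
  ∃ b : Baire → α → Bool, OracleComputable D b ∧ ∀ p ∈ D, ∀ a, b p a = true ↔ P p a

section
variable {α β γ σ : Type*} [Primcodable α] [Primcodable β] [Primcodable γ] [Primcodable σ]
  {D : Set Baire}

namespace OracleComputable

theorem congr {f g : Baire → α → σ} (hf : OracleComputable D f)
    (h : ∀ p ∈ D, ∀ a, f p a = g p a) : OracleComputable D g := by
  obtain ⟨φ, hφ, H⟩ := hf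
  exact ⟨φ, hφ, fun p hp a => by simpa only [h p hp a] using H p hp a⟩

theorem of_computable {g : α → σ} (hg : Computable g) : OracleComputable D fun _ a => g a :=
  ⟨fun _ a => some (g a), Computable.option_some.comp (hg.comp Computable.snd),
    fun _ _ _ => ⟨fun _ _ h => (Option.some.inj h).symm, Eventually.of_forall fun _ => rfl⟩⟩

theorem const (c : σ) : OracleComputable D fun _ (_ : α) => c :=
  of_computable (Computable.const c)

theorem id : OracleComputable D fun _ (a : α) => a := of_computable Computable.id

/-- Substitution of an oracle computable function for the second argument. -/
theorem app {f : Baire → β → σ} {g : Baire → α → β} (hf : OracleComputable D f)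
    (hg : OracleComputable D g) : OracleComputable D fun p a => f p (g p a) := by
  obtain ⟨φ, hφ, H⟩ := hf
  obtain ⟨ψ, hψ, G⟩ := hg
  refine ⟨fun l a => (ψ l a).bind (φ l), Computable.option_bind hψ
    (hφ.comp (Computable.fst.comp Computable.fst) Computable.snd), fun p hp a => ⟨?_, ?_⟩⟩
  · intro k b h
    obtain ⟨c, hc, hb⟩ := Option.bind_eq_some_iff.1 h
    obtain rfl := (G p hp a).1 k c hc
    exact (H p hp _).1 k b hb
  · filter_upwards [(G p hp a).2, (H p hp (g p a)).2] with k h1 h2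
    simp [h1, h2]

theorem map {F : β → σ} (hF : Computable F) {f : Baire → α → β} (hf : OracleComputable D f) :
    OracleComputable D fun p a => F (f p a) :=
  app (of_computable hF) hf

theorem prodMk {f : Baire → α → β} {g : Baire → α → γ} (hf : OracleComputable D f)
    (hg : OracleComputable D g) : OracleComputable D fun p a => (f p a, g p a) := by
  obtain ⟨φ, hφ, H⟩ := hf
  obtain ⟨ψ, hψ, G⟩ := hg
  refine ⟨fun l a => (φ l a).bind fun b => (ψ l a).map fun c => (b, c),
    Computable.option_bind hφ (Computable.option_map (hψ.comp (Computable.fst.comp Computable.fst)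
      (Computable.snd.comp Computable.fst))
      ((Computable.snd.comp Computable.fst).pair Computable.snd)), fun p hp a => ⟨?_, ?_⟩⟩
  · intro k b h
    obtain ⟨c, hc, hb⟩ := Option.bind_eq_some_iff.1 h
    obtain ⟨d, hd, rfl⟩ := Option.map_eq_some_iff.1 hb
    rw [(H p hp a).1 k c hc, (G p hp a).1 k d hd]
  · filter_upwards [(H p hp a).2, (G p hp a).2] with k h1 h2
    simp [h1, h2]

theorem map₂ {F : β → γ → σ} (hF : Computable₂ F) {f : Baire → α → β} {g : Baire → α → γ}
    (hf : OracleComputable D f) (hg : OracleComputable D g) :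
    OracleComputable D fun p a => F (f p a) (g p a) :=
  map (F := fun x : β × γ => F x.1 x.2) hF (hf.prodMk hg)

theorem length_initSeg (p : Baire) (k : ℕ) : (initSeg p k).length = k := by simp [initSeg]

theorem getElem?_initSeg (p : Baire) (k n : ℕ) :
    (initSeg p k)[n]? = if n < k then some (p n) else none := by
  split_ifs with h <;> simp [initSeg, h]

/-- Questions to the oracle. -/
theorem query {g : Baire → α → ℕ} (hg : OracleComputable D g) :
    OracleComputable D fun p a => p (g p a) := by
  refine app (f := fun p n => p n) ⟨fun l n => l[n]?, Computable.list_getElem?, ?_⟩ hg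
  intro p _ n
  refine ⟨fun k b h => ?_, ?_⟩
  · simp only [getElem?_initSeg] at h
    split_ifs at h
    exact (Option.some.inj h).symm
  · filter_upwards [eventually_gt_atTop n] with k hk
    simp [getElem?_initSeg, hk]

/-- Primitive recursion. -/
theorem nat_rec {f : Baire → α → ℕ} {g : Baire → α → σ} {h : Baire → α → ℕ → σ → σ}
    (hf : OracleComputable D f) (hg : OracleComputable D g)
    (hh : OracleComputable D fun p (x : α × ℕ × σ) => h p x.1 x.2.1 x.2.2) :
    OracleComputable D fun p a => (Nat.rec (g p a) (h p a) (f p a) : σ) := by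
  obtain ⟨φ, hφ, H⟩ := hg
  obtain ⟨χ, hχ, G⟩ := hh
  suffices OracleComputable D fun p (x : α × ℕ) => (Nat.rec (g p x.1) (h p x.1) x.2 : σ) from
    app this (id.prodMk hf)
  refine ⟨fun l x => (Nat.rec (φ l x.1) (fun n s => s.bind fun s => χ l (x.1, n, s)) x.2 :
    Option σ), ?_, ?_⟩
  · refine Computable.nat_rec (f := fun y : List ℕ × α × ℕ => y.2.2)
      (h := fun y z => z.2.bind fun s => χ y.1 (y.2.1, z.1, s)) (Computable.snd.comp Computable.snd)
      (hφ.comp Computable.fst (Computable.fst.comp Computable.snd)) ?_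
    refine Computable.option_bind (Computable.snd.comp Computable.snd) ?_
    exact hχ.comp (Computable.fst.comp (Computable.fst.comp Computable.fst))
      (((Computable.fst.comp (Computable.snd.comp (Computable.fst.comp Computable.fst)))).pair
        ((Computable.fst.comp (Computable.snd.comp Computable.fst)).pair Computable.snd))
  · rintro p hp ⟨a, n⟩
    induction n with
    | zero => exact H p hp a
    | succ n ih =>
      refine ⟨fun k b e => ?_, ?_⟩
      · obtain ⟨c, hc, hb⟩ := Option.bind_eq_some_iff.1 e
        obtain rfl := ih.1 k c hc
        exact (G p hp _).1 k b hb
      · filter_upwards [ih.2, (G p hp (a, n, Nat.rec (g p a) (h p a) n)).2] with k h1 h2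
        exact (congrArg (fun s => s.bind fun s => χ (initSeg p k) (a, n, s)) h1).trans h2

/-- Unbounded search: it suffices to have a computable sequence of attempts at the value of `f`,
none of which is wrong and at least one of which succeeds. -/
theorem search {f : Baire → α → σ} {g : Baire → α → ℕ → Option σ}
    (hg : OracleComputable D fun p (x : α × ℕ) => g p x.1 x.2)
    (h : ∀ p ∈ D, ∀ a, (∀ m b, g p a m = some b → b = f p a) ∧ ∃ m, (g p a m).isSome) :
    OracleComputable D f := by
  obtain ⟨φ, hφ, H⟩ := hg
  -- The recursion below runs through `m < N` and keeps the first answer that the algorithm for `g`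
  -- gives on `l`. An `m` on which that algorithm is still undecided is skipped and not waited for.
  have key : ∀ (l : List ℕ) (a : α) (N : ℕ) (b : σ), (Nat.rec none
      (fun m s => Option.casesOn s (φ l (a, m)).join some) N : Option σ) = some b →
      ∃ m, φ l (a, m) = some (some b) := by
    intro l a N b
    induction N with
    | zero => intro e; cases e
    | succ N ih =>
      simp only
      generalize (Nat.rec none
        (fun m s => Option.casesOn s (φ l (a, m)).join some) N : Option σ) = t at ih ⊢
      cases t with
      | none => exact fun e => ⟨N, Option.join_eq_some_iff.1 e⟩
      | some c => exact ih
  have key' : ∀ (l : List ℕ) (a : α) (N m : ℕ) (b : σ), m < N → φ l (a, m) = some (some b) →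
      ∃ c, (Nat.rec none (fun m s => Option.casesOn s (φ l (a, m)).join some) N : Option σ)
        = some c := by
    intro l a N m b hm e
    induction N with
    | zero => omega
    | succ N ih =>
      simp only
      rcases Nat.lt_succ_iff_lt_or_eq.1 hm with hm | rfl
      · obtain ⟨c, hc⟩ := ih hm
        exact ⟨c, by rw [hc]⟩
      · generalize (Nat.rec none
          (fun m s => Option.casesOn s (φ l (a, m)).join some) m : Option σ) = t
        cases t with
        | none => exact ⟨b, by simp [e]⟩
        | some c => exact ⟨c, rfl⟩
  refine ⟨fun l a => Nat.rec none (fun m s => Option.casesOn s (φ l (a, m)).join some) l.length,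
    ?_, fun p hp a => ?_⟩
  · have join : Computable (Option.join : Option (Option σ) → Option σ) :=
      (Computable.option_bind (f := fun x : Option (Option σ) => x) (g := fun _ y => y)
        Computable.id Computable.snd).of_eq fun x => by cases x <;> rfl
    refine Computable.nat_rec (f := fun y : List ℕ × α => y.1.length)
      (g := fun _ => (none : Option σ)) (h := fun y z =>
        (Option.casesOn z.2 (φ y.1 (y.2, z.1)).join some : Option σ))
      (Computable.list_length.comp Computable.fst) (Computable.const none) ?_
    refine Computable.option_casesOn (o := fun y : (List ℕ × α) × ℕ × Option σ => y.2.2)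
      (f := fun y => (φ y.1.1 (y.1.2, y.2.1)).join) (g := fun _ b => some b)
      (Computable.snd.comp Computable.snd) (join.comp ?_)
      (Computable.option_some.comp Computable.snd)
    exact hφ.comp (Computable.fst.comp Computable.fst) ((Computable.snd.comp Computable.fst).pair
      (Computable.fst.comp Computable.snd))
  · have sound : ∀ k b, (Nat.rec none (fun m s => Option.casesOn s
        (φ (initSeg p k) (a, m)).join some) (initSeg p k).length : Option σ) = some b →
        b = f p a := by
      intro k b e
      obtain ⟨m, hm⟩ := key _ _ _ _ e
      exact (h p hp a).1 m b ((H p hp (a, m)).1 k _ hm).symm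
    refine ⟨sound, ?_⟩
    obtain ⟨m, hm⟩ := (h p hp a).2
    obtain ⟨b, hb⟩ := Option.isSome_iff_exists.1 hm
    filter_upwards [(H p hp (a, m)).2, eventually_gt_atTop m] with k hk hk'
    simp only [hb] at hk
    obtain ⟨c, hc⟩ := key' _ a (initSeg p k).length m b (by rwa [length_initSeg]) hk
    rw [hc, sound k c hc]

/-- Substitution of a computable functional for the oracle: the algorithm for `f` is run on the
longest initial segment of `G p` that can be computed from the given initial segment of `p`. -/
theorem subst {E : Set Baire} {f : Baire → α → σ} {G : Baire → Baire} (hf : OracleComputable E f)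
    (hG : OracleComputable D G) (h : ∀ p ∈ D, G p ∈ E) : OracleComputable D fun p => f (G p) := by
  obtain ⟨φ, hφ, H⟩ := hf
  obtain ⟨ψ, hψ, K⟩ := hG
  -- the first `N` values of `G p`, or fewer if the computation of one of them does not finish
  let u : List ℕ → ℕ → List ℕ := fun l N => Nat.rec []
    (fun m s => Option.casesOn (ψ l s.length) s fun b => s ++ [b]) N
  have u_succ : ∀ l N, u l (N + 1) =
      Option.casesOn (ψ l (u l N).length) (u l N) fun b => u l N ++ [b] := fun _ _ => rfl
  have initSeg_succ : ∀ (p : Baire) (m : ℕ), initSeg p m ++ [p m] = initSeg p (m + 1) := by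
    intro p m; simp [initSeg, List.range_succ]
  have hu : ∀ p ∈ D, ∀ k N, ∃ m, u (initSeg p k) N = initSeg (G p) m := by
    intro p hp k N
    induction N with
    | zero => exact ⟨0, rfl⟩
    | succ N ih =>
      obtain ⟨m, hm⟩ := ih
      rw [u_succ, hm, length_initSeg]
      cases e : ψ (initSeg p k) m with
      | none => exact ⟨m, rfl⟩
      | some b =>
        obtain rfl := (K p hp m).1 k b e
        exact ⟨m + 1, initSeg_succ _ _⟩
  have hlen : ∀ p ∈ D, ∀ M, ∀ᶠ k in atTop, ∀ N ≥ M, M ≤ (u (initSeg p k) N).length := by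
    intro p hp M
    have h1 : ∀ᶠ k in atTop, ∀ m < M, ψ (initSeg p k) m = some (G p m) :=
      (Filter.eventually_all_finite (Set.finite_lt_nat M)).2 fun m _ => (K p hp m).2
    filter_upwards [h1] with k hk
    have h2 : ∀ N, min N M ≤ (u (initSeg p k) N).length := by
      intro N
      induction N with
      | zero => simp
      | succ N ih =>
        rw [u_succ]
        by_cases hlt : (u (initSeg p k) N).length < M
        · rw [hk _ hlt]
          simp only [List.length_append, List.length_singleton]
          omega
        · cases ψ (initSeg p k) (u (initSeg p k) N).length <;>
            simp <;> omega
    intro N hN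
    have := h2 N
    omega
  refine ⟨fun l a => φ (u l l.length) a, ?_, fun p hp a => ⟨fun k b e => ?_, ?_⟩⟩
  · have hu' : Computable fun l : List ℕ => u l l.length := by
      refine Computable.nat_rec (f := List.length) (g := fun _ => ([] : List ℕ)) (h := fun l z =>
        (Option.casesOn (ψ l z.2.length) z.2 fun b => z.2 ++ [b] : List ℕ))
        Computable.list_length (Computable.const []) ?_
      refine Computable.option_casesOn (hψ.comp Computable.fst (Computable.list_length.comp
        (Computable.snd.comp Computable.snd))) (Computable.snd.comp Computable.snd) ?_
      exact Computable.list_concat.comp (Computable.snd.comp (Computable.snd.comp Computable.fst))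
        Computable.snd
    exact hφ.comp (hu'.comp Computable.fst) Computable.snd
  · obtain ⟨m, hm⟩ := hu p hp k (initSeg p k).length
    simp only [hm] at e
    exact (H _ (h p hp) a).1 m b e
  · obtain ⟨M, hM⟩ := eventually_atTop.1 (H _ (h p hp) a).2
    filter_upwards [hlen p hp M, eventually_ge_atTop M] with k hk hk'
    obtain ⟨m, hm⟩ := hu p hp k (initSeg p k).length
    have h3 := hk (initSeg p k).length (by rwa [length_initSeg])
    rw [hm, length_initSeg] at h3
    rw [hm]
    exact hM m h3

theorem fst {f : Baire → α → β × γ} (hf : OracleComputable D f) :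
    OracleComputable D fun p a => (f p a).1 := map Computable.fst hf

theorem snd {f : Baire → α → β × γ} (hf : OracleComputable D f) :
    OracleComputable D fun p a => (f p a).2 := map Computable.snd hf

theorem some {f : Baire → α → β} (hf : OracleComputable D f) :
    OracleComputable D fun p a => some (f p a) := map Computable.option_some hf

theorem succ {f : Baire → α → ℕ} (hf : OracleComputable D f) :
    OracleComputable D fun p a => f p a + 1 := map Computable.succ hf

theorem unpair_fst {f : Baire → α → ℕ} (hf : OracleComputable D f) :
    OracleComputable D fun p a => (f p a).unpair.1 :=
  fst (map Computable.unpair hf)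

theorem unpair_snd {f : Baire → α → ℕ} (hf : OracleComputable D f) :
    OracleComputable D fun p a => (f p a).unpair.2 :=
  snd (map Computable.unpair hf)

theorem natPair {f g : Baire → α → ℕ} (hf : OracleComputable D f) (hg : OracleComputable D g) :
    OracleComputable D fun p a => Nat.pair (f p a) (g p a) :=
  map₂ Primrec₂.natPair.to_comp hf hg

theorem add {f g : Baire → α → ℕ} (hf : OracleComputable D f) (hg : OracleComputable D g) :
    OracleComputable D fun p a => f p a + g p a := map₂ Primrec.nat_add.to_comp hf hg

theorem sub {f g : Baire → α → ℕ} (hf : OracleComputable D f) (hg : OracleComputable D g) :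
    OracleComputable D fun p a => f p a - g p a := map₂ Primrec.nat_sub.to_comp hf hg

theorem mul {f g : Baire → α → ℕ} (hf : OracleComputable D f) (hg : OracleComputable D g) :
    OracleComputable D fun p a => f p a * g p a := map₂ Primrec.nat_mul.to_comp hf hg

theorem div {f g : Baire → α → ℕ} (hf : OracleComputable D f) (hg : OracleComputable D g) :
    OracleComputable D fun p a => f p a / g p a := map₂ Primrec.nat_div.to_comp hf hg

theorem mod {f g : Baire → α → ℕ} (hf : OracleComputable D f) (hg : OracleComputable D g) :
    OracleComputable D fun p a => f p a % g p a := map₂ Primrec.nat_mod.to_comp hf hg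

theorem pow {f g : Baire → α → ℕ} (hf : OracleComputable D f) (hg : OracleComputable D g) :
    OracleComputable D fun p a => f p a ^ g p a :=
  map₂ (Primrec₂.unpaired'.1 Nat.Primrec.pow).to_comp hf hg

end OracleComputable

open OracleComputable

namespace OracleDecidable

theorem congr {P Q : Baire → α → Prop} (hP : OracleDecidable D P)
    (h : ∀ p ∈ D, ∀ a, P p a ↔ Q p a) : OracleDecidable D Q := by
  obtain ⟨b, hb, H⟩ := hP
  exact ⟨b, hb, fun p hp a => (H p hp a).trans (h p hp a)⟩

theorem app {P : Baire → β → Prop} {f : Baire → α → β} (hP : OracleDecidable D P)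
    (hf : OracleComputable D f) : OracleDecidable D fun p a => P p (f p a) := by
  obtain ⟨b, hb, H⟩ := hP
  exact ⟨fun p a => b p (f p a), OracleComputable.app hb hf, fun p hp a => H p hp _⟩

theorem not {P : Baire → α → Prop} (hP : OracleDecidable D P) :
    OracleDecidable D fun p a => ¬ P p a := by
  obtain ⟨b, hb, H⟩ := hP
  refine ⟨fun p a => !b p a, map Primrec.not.to_comp hb, fun p hp a => ?_⟩
  simp [← H p hp a]

theorem and {P Q : Baire → α → Prop} (hP : OracleDecidable D P) (hQ : OracleDecidable D Q) :
    OracleDecidable D fun p a => P p a ∧ Q p a := by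
  obtain ⟨b, hb, H⟩ := hP
  obtain ⟨c, hc, G⟩ := hQ
  refine ⟨fun p a => b p a && c p a, map₂ Primrec.and.to_comp hb hc, fun p hp a => ?_⟩
  simp [← H p hp a, ← G p hp a]

theorem or {P Q : Baire → α → Prop} (hP : OracleDecidable D P) (hQ : OracleDecidable D Q) :
    OracleDecidable D fun p a => P p a ∨ Q p a :=
  (hP.not.and hQ.not).not.congr fun p _ a => by tauto

theorem imp {P Q : Baire → α → Prop} (hP : OracleDecidable D P) (hQ : OracleDecidable D Q) :
    OracleDecidable D fun p a => P p a → Q p a :=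
  (hP.not.or hQ).congr fun p _ a => by tauto

theorem eq {f g : Baire → α → ℕ} (hf : OracleComputable D f) (hg : OracleComputable D g) :
    OracleDecidable D fun p a => f p a = g p a :=
  ⟨fun p a => decide (f p a = g p a), map₂ (F := fun a b : ℕ => decide (a = b))
    (PrimrecPred.decide Primrec.eq).to_comp hf hg, fun p _ a => by simp⟩

theorem le {f g : Baire → α → ℕ} (hf : OracleComputable D f) (hg : OracleComputable D g) :
    OracleDecidable D fun p a => f p a ≤ g p a :=
  ⟨fun p a => decide (f p a ≤ g p a), map₂ (F := fun a b : ℕ => decide (a ≤ b))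
    (PrimrecPred.decide Primrec.nat_le).to_comp hf hg, fun p _ a => by simp⟩

theorem lt {f g : Baire → α → ℕ} (hf : OracleComputable D f) (hg : OracleComputable D g) :
    OracleDecidable D fun p a => f p a < g p a :=
  (le hf.succ hg).congr fun _ _ _ => Nat.succ_le_iff

/-- Bounded quantification. -/
theorem exists_lt {P : Baire → α → ℕ → Prop} {f : Baire → α → ℕ} (hf : OracleComputable D f)
    (hP : OracleDecidable D fun p (x : α × ℕ) => P p x.1 x.2) :
    OracleDecidable D fun p a => ∃ i < f p a, P p a i := by
  obtain ⟨b, hb, H⟩ := hP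
  refine ⟨fun p a => Nat.rec false (fun n s => s || b p (a, n)) (f p a),
    nat_rec (g := fun _ _ => false) (h := fun p a n s => s || b p (a, n)) hf (const false)
      (map₂ Primrec.or.to_comp id.snd.snd (OracleComputable.app hb (id.fst.prodMk id.snd.fst))),
      fun p hp a => ?_⟩
  suffices ∀ N, (Nat.rec false (fun n s => s || b p (a, n)) N : Bool) = true ↔ ∃ i < N, P p a i from
    this _
  intro N
  induction N with
  | zero => simp
  | succ N ih =>
    simp only [Bool.or_eq_true, ih, H p hp, Nat.exists_lt_succ_right]

theorem forall_lt {P : Baire → α → ℕ → Prop} {f : Baire → α → ℕ} (hf : OracleComputable D f)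
    (hP : OracleDecidable D fun p (x : α × ℕ) => P p x.1 x.2) :
    OracleDecidable D fun p a => ∀ i < f p a, P p a i :=
  (exists_lt (P := fun p a i => ¬ P p a i) hf hP.not).not.congr fun p _ a => by push Not; rfl

end OracleDecidable

namespace OracleComputable

theorem ite {P : Baire → α → Prop} [∀ p a, Decidable (P p a)] {f g : Baire → α → σ}
    (hP : OracleDecidable D P) (hf : OracleComputable D f) (hg : OracleComputable D g) :
    OracleComputable D fun p a => if P p a then f p a else g p a := by
  obtain ⟨b, hb, H⟩ := hP
  refine congr (f := fun p a => cond (b p a) (f p a) (g p a)) ?_ fun p hp a => ?_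
  · exact map (F := fun x : Bool × σ × σ => cond x.1 x.2.1 x.2.2)
      (Computable.cond Computable.fst (Computable.fst.comp Computable.snd)
        (Computable.snd.comp Computable.snd)) (hb.prodMk (hf.prodMk hg))
  · have := H p hp a
    by_cases h : P p a
    · simp [h, this.2 h]
    · have h' : b p a = false := by rw [← Bool.not_eq_true, this]; exact h
      simp [h, h']

/-- The least number with a decidable property. -/
theorem sInf {P : Baire → α → ℕ → Prop} (hP : OracleDecidable D fun p (x : α × ℕ) => P p x.1 x.2)
    (h : ∀ p ∈ D, ∀ a, ∃ n, P p a n) : OracleComputable D fun p a => sInf {n | P p a n} := by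
  classical
  refine search (g := fun p a m => if P p a m ∧ ∀ j < m, ¬ P p a j then Option.some m else none)
    (ite (hP.and (OracleDecidable.forall_lt id.snd
      (hP.not.app (id.fst.fst.prodMk id.snd)))) id.snd.some (const none)) fun p hp a => ?_
  refine ⟨fun m b e => ?_, ?_⟩
  · split_ifs at e with hm
    obtain rfl := Option.some.inj e
    exact le_antisymm (le_csInf (h p hp a) fun j hj => not_lt.1 fun hlt => hm.2 j hlt hj)
      (Nat.sInf_le hm.1)
  · refine ⟨InfSet.sInf {n | P p a n}, ?_⟩
    rw [if_pos ⟨Nat.sInf_mem (h p hp a), fun j hj => Nat.notMem_of_lt_sInf hj⟩]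
    rfl

theorem pair {G H : Baire → Baire} (hG : OracleComputable D G) (hH : OracleComputable D H) :
    OracleComputable D fun p => pair (G p) (H p) :=
  ite (OracleDecidable.eq (id.mod (const 2)) (const 0)) (app hG (id.div (const 2)))
    (app hH (id.div (const 2)))

theorem cons {g : Baire → ℕ} {G : Baire → Baire} (hg : OracleComputable D fun p (_ : ℕ) => g p)
    (hG : OracleComputable D G) : OracleComputable D fun p => cons (g p) (G p) := by
  refine (ite (OracleDecidable.eq id (const 0)) hg (app hG (id.sub (const 1)))).congr ?_
  rintro p - (_ | n) <;> simp [Weihrauch.cons]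

theorem fst_comp {G : Baire → Baire} (hG : OracleComputable D G) :
    OracleComputable D fun p => Weihrauch.fst (G p) := app (f := G) hG ((const 2).mul id)

theorem snd_comp {G : Baire → Baire} (hG : OracleComputable D G) :
    OracleComputable D fun p => Weihrauch.snd (G p) := app (f := G) hG ((const 2).mul id).succ

theorem baire_fst : OracleComputable D Weihrauch.fst := fst_comp (query id)

theorem baire_snd : OracleComputable D Weihrauch.snd := snd_comp (query id)

/-- A functional that is computable on `D`, with domain cut down to `D`. -/
theorem computableFunctional {G : Baire → Baire} (hG : OracleComputable D G) :
    ComputableFunctional fun p => ⟨p ∈ D, fun _ => G p⟩ := by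
  obtain ⟨φ, hφ, H⟩ := hG
  refine ⟨φ, hφ, ?_⟩
  rintro p q ⟨hp, rfl⟩ n
  classical
  obtain ⟨h1, h2⟩ := H p hp n
  refine ⟨Nat.find h2.exists, Nat.find_spec h2.exists, fun j hj => ?_⟩
  cases e : φ (initSeg p j) n with
  | none => rfl
  | some b => exact absurd (h1 j b e ▸ e) (Nat.find_min h2.exists hj)

end OracleComputable
end

/-! ### Weihrauch reductions by everywhere defined functionals -/

/-- A Weihrauch reduction of `g` to `f` whose two functionals are given as functions, computable
on the instances of `g`, respectively on the pairs of a solution supplied by `f` and an instance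
of `g`. -/
structure ReducibleVia (g f : Problem) (h k : Baire → Baire) : Prop where
  computable_left : OracleComputable g.dom h
  computable_right :
    OracleComputable {q | snd q ∈ g.dom ∧ fst q ∈ f.sol (h (snd q))} k
  mem_dom : ∀ p ∈ g.dom, h p ∈ f.dom
  mem_sol : ∀ p ∈ g.dom, ∀ y ∈ f.sol (h p), k (pair y p) ∈ g.sol p

namespace ReducibleVia

theorem reducible {g f : Problem} {h k : Baire → Baire} (H : ReducibleVia g f h k) :
    Reducible g f := by
  refine ⟨_, _, H.computable_left.computableFunctional, H.computable_right.computableFunctional,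
    fun F hF p hp => ?_⟩
  obtain ⟨y, hy, hy'⟩ := hF (h p) (H.mem_dom p hp)
  refine ⟨k (pair y p), ?_, H.mem_sol p hp y hy'⟩
  refine Part.mem_bind (a := h p) ⟨hp, rfl⟩ (Part.mem_bind hy ⟨?_, rfl⟩)
  change snd (pair y p) ∈ g.dom ∧ fst (pair y p) ∈ f.sol (h (snd (pair y p)))
  rw [snd_pair, fst_pair]
  exact ⟨hp, hy'⟩

theorem trans {g f e : Problem} {h₁ k₁ h₂ k₂ : Baire → Baire} (H₁ : ReducibleVia g f h₁ k₁)
    (H₂ : ReducibleVia f e h₂ k₂) : ReducibleVia g e (fun p => h₂ (h₁ p))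
      fun q => k₁ (pair (k₂ (pair (fst q) (h₁ (snd q)))) (snd q)) where
  computable_left := OracleComputable.subst H₂.computable_left H₁.computable_left H₁.mem_dom
  computable_right := by
    have h1 : OracleComputable {q | snd q ∈ g.dom ∧ fst q ∈ e.sol (h₂ (h₁ (snd q)))}
        fun q => pair (fst q) (h₁ (snd q)) :=
      OracleComputable.baire_fst.pair (OracleComputable.subst H₁.computable_left
        OracleComputable.baire_snd fun _ hq => hq.1)
    refine OracleComputable.subst H₁.computable_right ((OracleComputable.subst
      H₂.computable_right h1 fun q hq => ?_).pair OracleComputable.baire_snd) fun q hq => ?_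
    · change snd (pair _ _) ∈ f.dom ∧ fst (pair _ _) ∈ e.sol (h₂ (snd (pair _ _)))
      rw [snd_pair, fst_pair]
      exact ⟨H₁.mem_dom _ hq.1, hq.2⟩
    · change snd (pair _ _) ∈ g.dom ∧ fst (pair _ _) ∈ f.sol (h₁ (snd (pair _ _)))
      rw [snd_pair, fst_pair]
      exact ⟨hq.1, H₂.mem_sol _ (H₁.mem_dom _ hq.1) _ hq.2⟩
  mem_dom p hp := H₂.mem_dom _ (H₁.mem_dom p hp)
  mem_sol p hp y hy := by
    rw [snd_pair, fst_pair]
    exact H₁.mem_sol p hp _ (H₂.mem_sol _ (H₁.mem_dom p hp) y hy)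

end ReducibleVia

/-! ### Finite sets of numbers as bit masks -/

open scoped Classical in
/-- The number with binary digit `1` at the places `i < N` with `P i` and `0` elsewhere: the code
of the finite set `{i < N | P i}`. -/
noncomputable def bitmask (P : ℕ → Prop) : ℕ → ℕ
  | 0 => 0
  | N + 1 => 2 ^ N * (if P N then 1 else 0) + bitmask P N

theorem bitmask_lt (P : ℕ → Prop) (N : ℕ) : bitmask P N < 2 ^ N := by
  induction N with
  | zero => simp [bitmask]
  | succ N ih =>
    rw [bitmask, pow_succ]
    split_ifs <;> omega

theorem testBit_bitmask (P : ℕ → Prop) (N i : ℕ) :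
    (bitmask P N).testBit i = true ↔ i < N ∧ P i := by
  induction N with
  | zero => simp [bitmask]
  | succ N ih =>
    rw [bitmask, Nat.testBit_two_pow_mul_add _ (bitmask_lt P N)]
    rcases lt_trichotomy i N with h | rfl | h
    · rw [if_pos h, ih]
      exact and_congr_left' (iff_of_true h (h.trans (Nat.lt_succ_self N)))
    · by_cases hP : P i <;> simp [hP]
    · obtain ⟨d, rfl⟩ : ∃ d, i = N + 1 + d := ⟨i - (N + 1), by omega⟩
      have e : N + 1 + d - N = d + 1 := by omega
      rw [if_neg (by omega), e]
      split_ifs <;> simp [Nat.testBit_succ] <;> omega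

theorem OracleDecidable.testBit {α : Type*} [Primcodable α] {D : Set Baire} {f g : Baire → α → ℕ}
    (hf : OracleComputable D f) (hg : OracleComputable D g) :
    OracleDecidable D fun p a => (f p a).testBit (g p a) = true :=
  (eq ((hf.div ((OracleComputable.const 2).pow hg)).mod (.const 2)) (.const 1)).congr
    fun p _ a => by simp [Nat.testBit_eq_decide_div_mod_eq]

theorem OracleComputable.bitmask {α : Type*} [Primcodable α] {D : Set Baire}
    {P : Baire → α → ℕ → Prop} {f : Baire → α → ℕ} (hf : OracleComputable D f)
    (hP : OracleDecidable D fun p (x : α × ℕ) => P p x.1 x.2) :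
    OracleComputable D fun p a => bitmask (P p a) (f p a) := by
  classical
  refine (nat_rec (g := fun _ _ => 0) (h := fun p a N s => 2 ^ N * (if P p a N then 1 else 0) + s)
    hf (const 0) ((((const 2).pow id.snd.fst).mul (ite (hP.app (id.fst.prodMk id.snd.fst))
      (const 1) (const 0))).add id.snd.snd)).congr fun p _ a => ?_
  generalize f p a = N
  induction N with
  | zero => rfl
  | succ N ih => simp only [Weihrauch.bitmask, ← ih]

/-! ### Names of instances -/

/-- The name of a structure on `{0, …, n - 1}` with table `t` together with a colouring `c`. -/
def instanceName (n : ℕ) (t c : ℕ → ℕ → ℕ) : Baire :=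
  cons n (pair (fun i => t i.unpair.1 i.unpair.2) fun i => c i.unpair.1 i.unpair.2)

theorem table_instanceName (n : ℕ) (t c : ℕ → ℕ → ℕ) (i j : ℕ) :
    table (instanceName n t c) i j = t i j := by
  simp [table, instanceName, cons, pair]

theorem colour_instanceName (n : ℕ) (t c : ℕ → ℕ → ℕ) (x y : ℕ) :
    colour (instanceName n t c) x y = c x y := by
  have h : (2 * Nat.pair x y + 1) / 2 = Nat.pair x y := by omega
  simp [colour, instanceName, cons, pair, Nat.add_mod, h]

theorem OracleComputable.instanceName {D : Set Baire} {n : Baire → ℕ} {t c : Baire → ℕ → ℕ → ℕ}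
    (hn : OracleComputable D fun p (_ : ℕ) => n p)
    (ht : OracleComputable D fun p (x : ℕ × ℕ) => t p x.1 x.2)
    (hc : OracleComputable D fun p (x : ℕ × ℕ) => c p x.1 x.2) :
    OracleComputable D fun p => instanceName (n p) (t p) (c p) :=
  hn.cons ((app ht (map Computable.unpair id)).pair (app hc (map Computable.unpair id)))

/-- The laws of an additive instance, in terms of the numbers in its name. -/
structure AdditiveLaws (n : ℕ) (t c : ℕ → ℕ → ℕ) : Prop where
  table_lt : ∀ i < n, ∀ j < n, t i j < n
  assoc : ∀ i < n, ∀ j < n, ∀ k < n, t (t i j) k = t i (t j k)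
  colour_lt : ∀ x y, x < y → c x y < n
  add : ∀ x y z, x < y → y < z → c x z = t (c x y) (c y z)

/-- The laws of an ordered instance, in terms of the numbers in its name. -/
structure OrderedLaws (n : ℕ) (t c : ℕ → ℕ → ℕ) : Prop where
  refl : ∀ i < n, t i i ≠ 0
  trans : ∀ i < n, ∀ j < n, ∀ k < n, t i j ≠ 0 → t j k ≠ 0 → t i k ≠ 0
  antisymm : ∀ i < n, ∀ j < n, t i j ≠ 0 → t j i ≠ 0 → i = j
  colour_lt : ∀ x y, x < y → c x y < n
  mono : ∀ x y y', x < y → y ≤ y' → t (c x y) (c x y') ≠ 0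

theorem AdditiveLaws.isAdditiveInstance {n : ℕ} {t c : ℕ → ℕ → ℕ} (h : AdditiveLaws n t c) :
    IsAdditiveInstance (instanceName n t c) := by
  have hlt : ∀ x y, x < max y (x + 1) := fun x y => by omega
  refine ⟨{ mul := fun i j : Fin n => ⟨t i j, h.table_lt i i.2 j j.2⟩
            mul_assoc := fun i j k => Fin.ext (h.assoc i i.2 j j.2 k k.2) },
    fun x y => (⟨c x (max y (x + 1)), h.colour_lt x _ (hlt x y)⟩ : Fin n),
    fun i j => table_instanceName n t c i j, fun x y hxy => ?_, fun x y z hxy hyz => Fin.ext ?_⟩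
  · simp only [colour_instanceName]
    rw [max_eq_left (Nat.succ_le_of_lt hxy)]
  · change c x (max z (x + 1)) = t (c x (max y (x + 1))) (c y (max z (y + 1)))
    rw [max_eq_left (show x + 1 ≤ z by omega), max_eq_left (Nat.succ_le_of_lt hxy),
      max_eq_left (Nat.succ_le_of_lt hyz)]
    exact h.add x y z hxy hyz

theorem OrderedLaws.isOrderedInstance {n : ℕ} {t c : ℕ → ℕ → ℕ} (h : OrderedLaws n t c) :
    IsOrderedInstance (instanceName n t c) := by
  have hlt : ∀ x y, x < max y (x + 1) := fun x y => by omega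
  let P : PartialOrder (Fin n) :=
    { le := fun i j => t i j ≠ 0
      lt := fun i j => t i j ≠ 0 ∧ ¬ t j i ≠ 0
      le_refl := fun i => h.refl i i.2
      le_trans := fun i j k => h.trans i i.2 j j.2 k k.2
      le_antisymm := fun i j hi hj => Fin.ext (h.antisymm i i.2 j j.2 hi hj) }
  refine ⟨P, fun x y => (⟨c x (max y (x + 1)), h.colour_lt x _ (hlt x y)⟩ : Fin n),
    fun i j => by rw [table_instanceName]; rfl, fun x y hxy => ?_, fun x y y' hxy hy => ?_⟩
  · simp only [colour_instanceName]
    rw [max_eq_left (Nat.succ_le_of_lt hxy)]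
  · change t (c x (max y (x + 1))) (c x (max y' (x + 1))) ≠ 0
    rw [max_eq_left (show x + 1 ≤ y' by omega), max_eq_left (Nat.succ_le_of_lt hxy)]
    exact h.mono x y y' hxy hy

theorem IsAdditiveInstance.laws {p : Baire} (h : IsAdditiveInstance p) :
    AdditiveLaws (size p) (table p) (colour p) := by
  obtain ⟨S, c, ht, hc, hadd⟩ := h
  have hlt : ∀ i j : Fin (size p), table p i j < size p := fun i j => by
    rw [ht]; exact (S.mul i j).2
  refine ⟨fun i hi j hj => hlt ⟨i, hi⟩ ⟨j, hj⟩, fun i hi j hj k hk => ?_,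
    fun x y hxy => by rw [hc x y hxy]; exact (c x y).2, fun x y z hxy hyz => ?_⟩
  · have h1 := ht ⟨i, hi⟩ ⟨j, hj⟩
    have h2 := ht ⟨j, hj⟩ ⟨k, hk⟩
    simp only at h1 h2
    rw [h1, h2]
    exact (ht _ ⟨k, hk⟩).trans ((congrArg Fin.val (S.mul_assoc ⟨i, hi⟩ ⟨j, hj⟩ ⟨k, hk⟩)).trans
      (ht ⟨i, hi⟩ _).symm)
  · rw [hc x y hxy, hc y z hyz, hc x z (hxy.trans hyz), ht, hadd x y z hxy hyz]
    rfl

theorem IsOrderedInstance.laws {p : Baire} (h : IsOrderedInstance p) :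
    OrderedLaws (size p) (table p) (colour p) := by
  obtain ⟨P, c, ht, hc, hmono⟩ := h
  refine ⟨fun i hi => (ht ⟨i, hi⟩ ⟨i, hi⟩).1 (P.le_refl _),
    fun i hi j hj k hk h1 h2 => (ht ⟨i, hi⟩ ⟨k, hk⟩).1 (P.le_trans _ _ _
      ((ht ⟨i, hi⟩ ⟨j, hj⟩).2 h1) ((ht ⟨j, hj⟩ ⟨k, hk⟩).2 h2)),
    fun i hi j hj h1 h2 => congrArg Fin.val (P.le_antisymm _ _
      ((ht ⟨i, hi⟩ ⟨j, hj⟩).2 h1) ((ht ⟨j, hj⟩ ⟨i, hi⟩).2 h2)),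
    fun x y hxy => by rw [hc x y hxy]; exact (c x y).2, fun x y y' hxy hy => ?_⟩
  rw [hc x y hxy, hc x y' (hxy.trans_le hy)]
  exact (ht _ _).1 (hmono x y y' hxy hy)

theorem OracleComputable.colour {α : Type*} [Primcodable α] {D : Set Baire} {G : Baire → Baire}
    (hG : OracleComputable D G) {f g : Baire → α → ℕ} (hf : OracleComputable D f)
    (hg : OracleComputable D g) : OracleComputable D fun p a => colour (G p) (f p a) (g p a) :=
  app hG (((const 2).mul (hf.natPair hg)).add (const 2))

theorem OracleComputable.table {α : Type*} [Primcodable α] {D : Set Baire} {G : Baire → Baire}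
    (hG : OracleComputable D G) {f g : Baire → α → ℕ} (hf : OracleComputable D f)
    (hg : OracleComputable D g) : OracleComputable D fun p a => table (G p) (f p a) (g p a) :=
  app hG ((const 2).mul (hf.natPair hg)).succ

theorem OracleComputable.size {α : Type*} [Primcodable α] {D : Set Baire} {G : Baire → Baire}
    (hG : OracleComputable D G) : OracleComputable D fun p (_ : α) => size (G p) :=
  app (f := fun p (_ : ℕ) => G p 0) (app hG (const 0)) (const 0)

/-! ### Greedy construction of an infinite set -/

open scoped Classical in
/-- The threshold reached by the greedy construction for `P` after the pairs with codes `< t` have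
been examined. The pair `(y, z)` is accepted if `P y z` holds and `y` is at least the threshold, and
the threshold is then raised to `z`. -/
noncomputable def threshold (P : ℕ → ℕ → Prop) : ℕ → ℕ
  | 0 => 0
  | t + 1 =>
    if threshold P t ≤ t.unpair.1 ∧ t.unpair.1 < t.unpair.2 ∧ P t.unpair.1 t.unpair.2 then
      t.unpair.2 else threshold P t

/-- The pair with code `t` is accepted by the greedy construction for `P`. -/
def Accepted (P : ℕ → ℕ → Prop) (t : ℕ) : Prop :=
  threshold P t ≤ t.unpair.1 ∧ t.unpair.1 < t.unpair.2 ∧ P t.unpair.1 t.unpair.2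

/-- The set of the first components of the accepted pairs. -/
def greedySet (P : ℕ → ℕ → Prop) : Set ℕ := {y | ∃ t, Accepted P t ∧ t.unpair.1 = y}

open scoped Classical in
theorem threshold_succ (P : ℕ → ℕ → Prop) (t : ℕ) : threshold P (t + 1) =
    if Accepted P t then t.unpair.2 else threshold P t := by
  by_cases h : Accepted P t
  · rw [if_pos h]; exact if_pos h
  · rw [if_neg h]; exact if_neg h

theorem threshold_mono (P : ℕ → ℕ → Prop) : Monotone (threshold P) := by
  refine monotone_nat_of_le_succ fun t => ?_
  rw [threshold_succ]
  split_ifs with h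
  · exact h.1.trans h.2.1.le
  · exact le_rfl

theorem Accepted.le_threshold {P : ℕ → ℕ → Prop} {t u : ℕ} (h : Accepted P t) (htu : t < u) :
    t.unpair.2 ≤ threshold P u := by
  refine le_trans ?_ (threshold_mono P (Nat.succ_le_of_lt htu))
  rw [Nat.succ_eq_add_one, threshold_succ, if_pos h]

/-- Between two elements `y < y'` of the greedy set there is a witness `z` for `P y z`. -/
theorem greedySet_spec {P : ℕ → ℕ → Prop} {y y' : ℕ} (hy : y ∈ greedySet P)
    (hy' : y' ∈ greedySet P) (h : y < y') : ∃ z, y < z ∧ z ≤ y' ∧ P y z := by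
  obtain ⟨t, ht, rfl⟩ := hy
  obtain ⟨u, hu, rfl⟩ := hy'
  refine ⟨t.unpair.2, ht.2.1, ?_, ht.2.2⟩
  rcases lt_trichotomy t u with htu | rfl | hut
  · exact (ht.le_threshold htu).trans hu.1
  · omega
  · have h1 := hu.le_threshold hut
    have h2 := hu.2.1
    have h3 := ht.1
    omega

theorem exists_accepted {P : ℕ → ℕ → Prop} (h : ∀ T, ∃ y ≥ T, ∃ z > y, P y z) (t : ℕ) :
    ∃ u ≥ t, Accepted P u := by
  by_contra! hcon
  -- without a further success the threshold does not move, so that a late pair with `P` is accepted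
  have hconst : ∀ u ≥ t, threshold P u = threshold P t := by
    intro u hu
    induction u, hu using Nat.le_induction with
    | base => rfl
    | succ u hu ih => rw [threshold_succ, if_neg (hcon u hu), ih]
  obtain ⟨y, hy, z, hz, hP⟩ := h (max t (threshold P t))
  have hu : t ≤ Nat.pair y z := (le_max_left _ _).trans (hy.trans (Nat.left_le_pair y z))
  refine hcon _ hu ⟨?_, ?_, ?_⟩ <;> simp only [Nat.unpair_pair]
  · rw [hconst _ hu]; exact (le_max_right _ _).trans hy
  · exact hz
  · exact hP

theorem greedySet_infinite {P : ℕ → ℕ → Prop} (h : ∀ T, ∃ y ≥ T, ∃ z > y, P y z) :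
    (greedySet P).Infinite := by
  refine Set.infinite_of_forall_exists_gt fun a => ?_
  have hunb : ∀ m, ∃ t, m ≤ threshold P t := by
    intro m
    induction m with
    | zero => exact ⟨0, le_rfl⟩
    | succ m ih =>
      obtain ⟨t, ht⟩ := ih
      obtain ⟨u, hu, hacc⟩ := exists_accepted h t
      have h1 := hacc.le_threshold (Nat.lt_succ_self u)
      have h2 := hacc.1
      have h3 := hacc.2.1
      have h4 := threshold_mono P hu
      exact ⟨u + 1, by rw [Nat.succ_eq_add_one] at h1; omega⟩
  obtain ⟨t, ht⟩ := hunb (a + 1)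
  obtain ⟨u, hu, hacc⟩ := exists_accepted h t
  exact ⟨u.unpair.1, ⟨u, hacc, rfl⟩, (Nat.lt_of_succ_le ht).trans_le
    ((threshold_mono P hu).trans hacc.1)⟩

/-- Membership of `n` in the greedy set is known once the threshold exceeds `n`. -/
theorem mem_greedySet_iff {P : ℕ → ℕ → Prop} {n t : ℕ} (h : n < threshold P t) :
    n ∈ greedySet P ↔ ∃ u < t, Accepted P u ∧ u.unpair.1 = n := by
  constructor
  · rintro ⟨u, hu, rfl⟩
    refine ⟨u, not_le.1 fun htu => ?_, hu, rfl⟩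
    have h1 := threshold_mono P htu
    have h2 := hu.1
    omega
  · rintro ⟨u, -, hu⟩
    exact ⟨u, hu⟩

theorem OracleComputable.greedySet {D : Set Baire} {P : Baire → ℕ → ℕ → Prop}
    (hP : OracleDecidable D fun p (x : ℕ × ℕ) => P p x.1 x.2)
    (h : ∀ p ∈ D, ∀ T, ∃ y ≥ T, ∃ z > y, P p y z) :
    OracleComputable D fun p => (greedySet (P p)).indicator (1 : Baire) := by
  classical
  have hthr : OracleComputable D fun p t => threshold (P p) t := by
    refine (nat_rec (g := fun _ (_ : ℕ) => 0) (h := fun p _ t s => if s ≤ t.unpair.1 ∧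
      t.unpair.1 < t.unpair.2 ∧ P p t.unpair.1 t.unpair.2 then t.unpair.2 else s) id (const 0)
      (ite (OracleDecidable.and (.le id.snd.snd id.snd.fst.unpair_fst)
        (.and (.lt id.snd.fst.unpair_fst id.snd.fst.unpair_snd)
          (hP.app (id.snd.fst.unpair_fst.prodMk id.snd.fst.unpair_snd)))) id.snd.fst.unpair_snd
          id.snd.snd)).congr fun p _ t => ?_
    induction t with
    | zero => rfl
    | succ t ih =>
      simp only at ih ⊢
      rw [ih, threshold]
  have hacc : OracleDecidable D fun p t => Accepted (P p) t :=
    OracleDecidable.and (.le hthr id.unpair_fst)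
      (.and (.lt id.unpair_fst id.unpair_snd) (hP.app (id.unpair_fst.prodMk id.unpair_snd)))
  refine search (g := fun p n t => if n < threshold (P p) t then
      Option.some (if ∃ u < t, Accepted (P p) u ∧ u.unpair.1 = n then 1 else 0) else none)
    (ite (.lt id.fst (app hthr id.snd)) (OracleComputable.some (ite
      (OracleDecidable.exists_lt id.snd ((hacc.app id.snd).and (.eq id.snd.unpair_fst id.fst.fst)))
      (OracleComputable.const 1)
        (OracleComputable.const 0))) (const none)) fun p hp n => ⟨fun t b e => ?_, ?_⟩
  · split_ifs at e with h1 h2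
    · obtain rfl := Option.some.inj e
      rw [Set.indicator_of_mem ((mem_greedySet_iff h1).2 h2)]; rfl
    · obtain rfl := Option.some.inj e
      rw [Set.indicator_of_notMem (mt (mem_greedySet_iff h1).1 h2)]
  · obtain ⟨y, ⟨u, hu, rfl⟩, hlt⟩ := (greedySet_infinite (h p hp)).exists_gt n
    have h1 := hu.le_threshold (Nat.lt_add_one u)
    have h2 := hu.2.1
    refine ⟨u + 1, ?_⟩
    rw [if_pos (by omega)]
    rfl

/-! ### From additive to right-ordered colourings -/

/-- The code of the set of all pairs `(s, t)` of colours `< n` such that `c x a = s` and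
`c a b = t` for some `x < a < b ≤ y`. As a function of `y` this set is increasing. -/
noncomputable def factorColour (n : ℕ) (c : ℕ → ℕ → ℕ) (x y : ℕ) : ℕ :=
  bitmask (fun i => ∃ b < y + 1, ∃ a < b, x < a ∧ c x a = i.unpair.1 ∧ c a b = i.unpair.2) (n * n)

open scoped Classical in
/-- The table of the inclusion order on the codes of subsets of `{0, …, N - 1}`. -/
noncomputable def subsetTable (N i j : ℕ) : ℕ :=
  if ∀ k < N, i.testBit k = true → j.testBit k = true then 1 else 0

theorem subsetTable_ne_zero {N i j : ℕ} :
    subsetTable N i j ≠ 0 ↔ ∀ k < N, i.testBit k = true → j.testBit k = true := by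
  unfold subsetTable
  split_ifs with h
  · simpa using h
  · simpa using h

theorem testBit_factorColour {n : ℕ} {c : ℕ → ℕ → ℕ} {x y s t : ℕ} (hs : s < n) (ht : t < n) :
    (factorColour n c x y).testBit (Nat.pair s t) = true ↔
      ∃ b ≤ y, ∃ a < b, x < a ∧ c x a = s ∧ c a b = t := by
  have hlt : Nat.pair s t < n * n := by
    have h := Nat.pair_lt_max_add_one_sq s t
    have h1 : max s t + 1 ≤ n := by omega
    exact h.trans_le (by rw [pow_two]; exact Nat.mul_le_mul h1 h1)
  rw [factorColour, testBit_bitmask]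
  simp only [hlt, Nat.unpair_pair, true_and, Nat.lt_succ_iff]

theorem orderedLaws_factorColour (n : ℕ) (c : ℕ → ℕ → ℕ) :
    OrderedLaws (2 ^ (n * n)) (subsetTable (n * n)) (factorColour n c) where
  refl i _ := subsetTable_ne_zero.2 fun _ _ h => h
  trans i _ j _ k _ h1 h2 := subsetTable_ne_zero.2 fun l hl h =>
    subsetTable_ne_zero.1 h2 l hl (subsetTable_ne_zero.1 h1 l hl h)
  antisymm i hi j hj h1 h2 := by
    refine Nat.eq_of_testBit_eq fun k => ?_
    rcases lt_or_ge k (n * n) with hk | hk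
    · exact Bool.eq_iff_iff.2 ⟨subsetTable_ne_zero.1 h1 k hk, subsetTable_ne_zero.1 h2 k hk⟩
    · have hpow := Nat.pow_le_pow_right (n := 2) (by norm_num) hk
      rw [Nat.testBit_lt_two_pow (hi.trans_le hpow), Nat.testBit_lt_two_pow (hj.trans_le hpow)]
  colour_lt x y _ := bitmask_lt _ _
  mono x y y' _ hy := subsetTable_ne_zero.2 fun k _ h => by
    rw [factorColour, testBit_bitmask] at h ⊢
    obtain ⟨hk, b, hb, h⟩ := h
    exact ⟨hk, b, by omega, h⟩

/-- The condition on an idempotent `e` under which `e` is the colour of an infinite homogeneous set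
for an additive colouring, when `F` is the colour of an infinite homogeneous set for the associated
`factorColour`: the pair `(e, e)` is in `F`, and `e` is a right multiple of every first component of
a pair in `F`. -/
def IsLeastColour (n : ℕ) (t : ℕ → ℕ → ℕ) (F e : ℕ) : Prop :=
  e < n ∧ F.testBit (Nat.pair e e) = true ∧ t e e = e ∧
    ∀ f < n, (∃ s < n, F.testBit (Nat.pair f s) = true) → ∃ v < n, t f v = e

section
variable {n : ℕ} {t c : ℕ → ℕ → ℕ} {F e : ℕ} {X : Set ℕ}

/-- Ramsey's theorem inside an infinite set. -/
theorem exists_homogeneous_subset (hc : ∀ x y, x < y → c x y < n) (hX : X.Infinite) :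
    ∃ a, ∃ Y ⊆ X, Y.Infinite ∧ HomogeneousWith c a Y := by
  have hf := Nat.nth_strictMono hX
  obtain ⟨a, Z, hZ, hZa⟩ := exists_homogeneous fun i j =>
    (⟨c (Nat.nth (· ∈ X) i) (Nat.nth (· ∈ X) (max j (i + 1))), hc _ _ (hf (by omega))⟩ : Fin n)
  refine ⟨a, Nat.nth (· ∈ X) '' Z, ?_, hZ.image hf.injective.injOn, ?_⟩
  · rintro _ ⟨i, -, rfl⟩
    exact Nat.nth_mem_of_infinite hX i
  · rintro _ ⟨i, hi, rfl⟩ _ ⟨j, hj, rfl⟩ hij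
    have hij' := hf.lt_iff_lt.1 hij
    rw [← hZa i hi j hj hij']
    simp only [max_eq_left (Nat.succ_le_of_lt hij')]

/-- Both components of a pair in the colour `F` of an infinite homogeneous set occur after every
element of that set. -/
theorem HomogeneousWith.mem_factorColour_iff (hXi : X.Infinite)
    (hX : HomogeneousWith (factorColour n c) F X) {x : ℕ} (hx : x ∈ X) {s u : ℕ} (hs : s < n)
    (hu : u < n) : F.testBit (Nat.pair s u) = true ↔
      ∃ a b, x < a ∧ a < b ∧ c x a = s ∧ c a b = u := by
  constructor
  · intro h
    obtain ⟨y, hy, hxy⟩ := hXi.exists_gt x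
    rw [← hX x hx y hy hxy, testBit_factorColour hs hu] at h
    obtain ⟨b, -, a, hab, hxa, h1, h2⟩ := h
    exact ⟨a, b, hxa, hab, h1, h2⟩
  · rintro ⟨a, b, hxa, hab, h1, h2⟩
    obtain ⟨y, hy, hby⟩ := hXi.exists_gt b
    rw [← hX x hx y hy (by omega), testBit_factorColour hs hu]
    exact ⟨b, hby.le, a, hab, hxa, h1, h2⟩

theorem exists_isLeastColour (L : AdditiveLaws n t c) (hXi : X.Infinite)
    (hX : HomogeneousWith (factorColour n c) F X) : ∃ e, IsLeastColour n t F e := by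
  obtain ⟨e, Y, hYX, hYi, hY⟩ := exists_homogeneous_subset L.colour_lt hXi
  obtain ⟨y₀, hy₀⟩ := hYi.nonempty
  obtain ⟨y₁, hy₁, h01⟩ := hYi.exists_gt y₀
  obtain ⟨y₂, hy₂, h12⟩ := hYi.exists_gt y₁
  have e01 := hY y₀ hy₀ y₁ hy₁ h01
  have e12 := hY y₁ hy₁ y₂ hy₂ h12
  have e02 := hY y₀ hy₀ y₂ hy₂ (h01.trans h12)
  have he : e < n := e01 ▸ L.colour_lt _ _ h01
  have hF := fun {s u} => hX.mem_factorColour_iff hXi (hYX hy₀) (s := s) (u := u)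
  refine ⟨e, he, (hF he he).2 ⟨y₁, y₂, h01, h12, e01, e12⟩, ?_, ?_⟩
  · have h := L.add _ _ _ h01 h12
    rw [e01, e12, e02] at h
    exact h.symm
  · rintro f hf ⟨s, hs, hfs⟩
    obtain ⟨a, b, h1, h2, rfl, rfl⟩ := (hF hf hs).1 hfs
    obtain ⟨y, hy, hay⟩ := hYi.exists_gt a
    refine ⟨c a y, L.colour_lt _ _ hay, ?_⟩
    rw [← L.add _ _ _ h1 hay]
    exact hY y₀ hy₀ y hy (h1.trans hay)

/-- The set `A` of all `s = e * s` with `(s, e) ∈ F` is mapped into itself by left multiplication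
with `c x x'`, for `x' ∈ X` far enough, and this map is a permutation because it is onto on the
right ideal of `e`. Hence `e = c x x' * s` with `s ∈ A`, and `s` occurs after `x'`. -/
theorem IsLeastColour.exists_gt (L : AdditiveLaws n t c) (hXi : X.Infinite)
    (hX : HomogeneousWith (factorColour n c) F X) (he : IsLeastColour n t F e) {x : ℕ} (hx : x ∈ X)
    (T : ℕ) : ∃ y ≥ T, ∃ z > y, x < y ∧ c x y = e ∧ c y z = e := by
  obtain ⟨hen, hee, hidem, hmul⟩ := he
  have hF := fun {x} (hx : x ∈ X) {s u} => hX.mem_factorColour_iff hXi hx (s := s) (u := u)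
  obtain ⟨a, -, hxa, -, hca, -⟩ := (hF hx hen hen).1 hee
  obtain ⟨x', hx', hlt⟩ := hXi.exists_gt (T + a)
  have hxx' : x < x' := by omega
  have hax' : a < x' := by omega
  set h := c x x' with hh
  have hhn : h < n := L.colour_lt _ _ hxx'
  have heh : t e h = h := by
    have hk := L.colour_lt _ _ hax'
    rw [hh, L.add _ _ _ hxa hax', hca, ← L.assoc e hen e hen _ hk, hidem]
  -- products with `h` of first components in `F` are again first components in `F`
  have hstep : ∀ s < n, ∀ u < n, F.testBit (Nat.pair s u) = true →
      F.testBit (Nat.pair (t h s) u) = true := by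
    intro s hs u hu hsu
    obtain ⟨a', b', h1, h2, rfl, rfl⟩ := (hF hx' hs hu).1 hsu
    exact (hF hx (L.table_lt _ hhn _ hs) hu).2
      ⟨a', b', hxx'.trans h1, h2, L.add _ _ _ hxx' h1, rfl⟩
  obtain ⟨v, hv, hhev⟩ := hmul (t h e) (L.table_lt _ hhn _ hen) ⟨e, hen, hstep e hen e hen hee⟩
  let I : Finset ℕ := (Finset.range n).filter fun s => t e s = s
  let A : Finset ℕ := I.filter fun s => F.testBit (Nat.pair s e) = true
  have hI : ∀ {s}, s ∈ I ↔ s < n ∧ t e s = s := by simp [I]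
  have hA : ∀ {s}, s ∈ A ↔ s ∈ I ∧ F.testBit (Nat.pair s e) = true := by simp [A]
  have hmapI : ∀ s ∈ I, t h s ∈ I := fun s hs => by
    obtain ⟨hs, -⟩ := hI.1 hs
    exact hI.2 ⟨L.table_lt _ hhn _ hs, by rw [← L.assoc e hen h hhn s hs, heh]⟩
  have hsurj : Set.SurjOn (t h) I I := by
    intro s hs
    obtain ⟨hs, hes⟩ := hI.1 hs
    have hvs := L.table_lt _ hv _ hs
    have hevs := L.table_lt _ hen _ hvs
    refine ⟨t e (t v s), hI.2 ⟨hevs, by rw [← L.assoc e hen e hen _ hvs, hidem]⟩, ?_⟩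
    rw [← L.assoc h hhn e hen _ hvs, ← L.assoc _ (L.table_lt _ hhn _ hen) v hv s hs, hhev, hes]
  have hinj : Set.InjOn (t h) I :=
    Finset.injOn_of_surjOn_of_card_le (t h) hmapI hsurj le_rfl
  have hsurjA : Set.SurjOn (t h) A A := by
    refine Finset.surjOn_of_injOn_of_card_le (t h) (fun s hs => ?_)
      (hinj.mono fun s hs => (hA.1 hs).1) le_rfl
    obtain ⟨hs, hsF⟩ := hA.1 hs
    exact hA.2 ⟨hmapI s hs, hstep s (hI.1 hs).1 e hen hsF⟩
  obtain ⟨s, hs, hhs⟩ := hsurjA (hA.2 ⟨hI.2 ⟨hen, hidem⟩, hee⟩ : e ∈ (A : Set ℕ))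
  obtain ⟨hs, hsF⟩ := hA.1 hs
  obtain ⟨y, z, h1, h2, hy, hz⟩ := (hF hx' (hI.1 hs).1 hen).1 hsF
  exact ⟨y, by omega, z, h2, hxx'.trans h1, by rw [L.add _ _ _ hxx' h1, hy, hhs], hz⟩

/-- Points `y < y'` seen from `x` in the idempotent colour `e` see each other in the colour `e` if
`y` sees some `z ≤ y'` in the colour `e`. -/
theorem AdditiveLaws.eq_of_eq (L : AdditiveLaws n t c) (hidem : t e e = e) {x y z y' : ℕ}
    (hxy : x < y) (hyz : y < z) (hzy : z ≤ y') (h1 : c x y = e) (h2 : c y z = e)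
    (h3 : c x y' = e) : c y y' = e := by
  rcases hzy.eq_or_lt with rfl | hzy
  · exact h2
  · have he : e < n := h2 ▸ L.colour_lt _ _ hyz
    have h4 := L.add _ _ _ hyz hzy
    have h5 := L.add _ _ _ hxy (hyz.trans hzy)
    rw [h1, h4, h2, ← L.assoc e he e he _ (L.colour_lt _ _ hzy), hidem, h3] at h5
    rw [h4, h2, ← h5]

theorem homogeneousWith_greedySet (L : AdditiveLaws n t c) (hidem : t e e = e) (x : ℕ) :
    HomogeneousWith c e (greedySet fun y z => x < y ∧ c x y = e ∧ c y z = e) := by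
  intro y hy y' hy' hlt
  obtain ⟨z, hyz, hzy, hxy, h1, h2⟩ := greedySet_spec hy hy' hlt
  obtain ⟨u, hu, rfl⟩ := hy'
  exact L.eq_of_eq hidem hxy hyz hzy h1 h2 hu.2.2.2.1

/-- A pair of elements of an infinite homogeneous set for `factorColour` bounds a pair of elements
of an infinite homogeneous set for `c`. -/
theorem exists_homogeneous_le (L : AdditiveLaws n t c) (hXi : X.Infinite)
    (hX : HomogeneousWith (factorColour n c) F X) {x y : ℕ} (hx : x ∈ X) (hy : y ∈ X)
    (hxy : x < y) : ∃ Y : Set ℕ, Y.Infinite ∧ Homogeneous c Y ∧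
      ∃ a ∈ Y, ∃ b ∈ Y, a < b ∧ b ≤ y := by
  obtain ⟨e, he⟩ := exists_isLeastColour L hXi hX
  obtain ⟨b, hby, a, hab, hxa, ha, hb⟩ := (testBit_factorColour he.1 he.1).1
    ((hX x hx y hy hxy).symm ▸ he.2.1 : (factorColour n c x y).testBit (Nat.pair e e) = true)
  have hG := homogeneousWith_greedySet L he.2.2.1 x
  have hGi := greedySet_infinite (he.exists_gt L hXi hX hx)
  have hGx : ∀ u ∈ greedySet (fun y z => x < y ∧ c x y = e ∧ c y z = e), c x u = e := by
    rintro _ ⟨u, hu, rfl⟩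
    exact hu.2.2.2.1
  refine ⟨{x, a} ∪ (greedySet (fun y z => x < y ∧ c x y = e ∧ c y z = e) \ Set.Iio b),
    (hGi.sdiff (Set.finite_Iio b)).mono Set.subset_union_right, ⟨e, ?_⟩, x, by simp, a, by simp,
    hxa, by omega⟩
  rintro u ((rfl | rfl) | ⟨hu, hbu⟩) w ((rfl | rfl) | ⟨hw, hbw⟩) huw
  · omega
  · exact ha
  · exact hGx w hw
  · omega
  · omega
  · exact L.eq_of_eq he.2.2.1 hxa hab (not_lt.1 hbw) ha hb (hGx w hw)
  · simp at hbu; omega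
  · simp at hbu; omega
  · exact hG u hu w hw huw

end

/-- The right-ordered instance of the `factorColour` of an additive instance. -/
noncomputable def orderedOfAdditive (p : Baire) : Baire :=
  instanceName (2 ^ (size p * size p)) (subsetTable (size p * size p))
    (factorColour (size p) (colour p))

theorem isOrderedInstance_orderedOfAdditive (p : Baire) :
    IsOrderedInstance (orderedOfAdditive p) :=
  (orderedLaws_factorColour _ _).isOrderedInstance

theorem colour_orderedOfAdditive (p : Baire) :
    colour (orderedOfAdditive p) = factorColour (size p) (colour p) := by
  funext x y
  exact colour_instanceName _ _ _ x y

section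
variable {α : Type*} [Primcodable α] {D : Set Baire} {G : Baire → Baire}

theorem OracleComputable.factorColour (hG : OracleComputable D G) {f g : Baire → α → ℕ}
    (hf : OracleComputable D f) (hg : OracleComputable D g) : OracleComputable D fun p a =>
      Weihrauch.factorColour (Weihrauch.size (G p)) (Weihrauch.colour (G p)) (f p a) (g p a) := by
  refine bitmask ((size hG).mul (size hG)) (.exists_lt (app hg id.fst).succ (.exists_lt id.snd ?_))
  have hf' : OracleComputable D fun p (x : ((α × ℕ) × ℕ) × ℕ) => f p x.1.1.1 :=
    app hf id.fst.fst.fst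
  exact .and (.lt hf' id.snd) (.and (.eq (colour hG hf' id.snd) id.fst.fst.snd.unpair_fst)
    (.eq (colour hG id.snd id.fst.snd) id.fst.fst.snd.unpair_snd))

theorem OracleDecidable.isLeastColour (hG : OracleComputable D G) {f g : Baire → α → ℕ}
    (hf : OracleComputable D f) (hg : OracleComputable D g) : OracleDecidable D fun p a =>
      IsLeastColour (size (G p)) (Weihrauch.table (G p)) (f p a) (g p a) := by
  refine .and (.lt hg (.size hG)) (.and (.testBit hf (hg.natPair hg))
    (.and (.eq (.table hG hg hg) hg) (.forall_lt (.size hG) (.imp (.exists_lt (.size hG) ?_)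
      (.exists_lt (.size hG) ?_)))))
  · exact .testBit (OracleComputable.app hf (.fst (.fst .id)))
      (.natPair (.snd (.fst .id)) (.snd .id))
  · exact .eq (.table hG (.snd (.fst .id)) (.snd .id)) (OracleComputable.app hg (.fst (.fst .id)))

end

theorem OracleComputable.orderedOfAdditive {D : Set Baire} :
    OracleComputable D orderedOfAdditive := by
  classical
  have hid : OracleComputable D fun p => p := query id
  have hN : OracleComputable D fun p (_ : ℕ × ℕ) => Weihrauch.size p * Weihrauch.size p :=
    (size hid).mul (size hid)
  refine instanceName ((const 2).pow ((size hid).mul (size hid))) ?_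
    (factorColour hid id.fst id.snd)
  have hlt : OracleDecidable D fun p (x : ℕ × ℕ) => ∀ k < Weihrauch.size p * Weihrauch.size p,
      x.1.testBit k = true → x.2.testBit k = true :=
    .forall_lt hN (.imp (.testBit id.fst.fst id.snd) (.testBit id.fst.snd id.snd))
  exact (ite hlt (const 1) (const 0)).congr fun p _ x => by rw [subsetTable]

theorem cART_le_cORT : ∃ k, ReducibleVia cART cORT orderedOfAdditive k := by
  refine ⟨fun q _ => sInf {e | IsLeastColour (size (snd q)) (table (snd q)) (fst q 0) e},
    .orderedOfAdditive, ?_, fun p _ => isOrderedInstance_orderedOfAdditive p, ?_⟩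
  · refine .sInf (.isLeastColour .baire_snd (.app .baire_fst (.const 0)) (.snd .id))
      fun q hq _ => ?_
    obtain ⟨hp, X, hXi, hX⟩ := hq
    rw [colour_orderedOfAdditive] at hX
    exact exists_isLeastColour (IsAdditiveInstance.laws hp) hXi hX
  · intro p hp y hy
    have L := IsAdditiveInstance.laws hp
    obtain ⟨X, hXi, hX⟩ := hy
    rw [colour_orderedOfAdditive] at hX
    have hmem : IsLeastColour (size p) (table p) (y 0)
        (sInf {e | IsLeastColour (size p) (table p) (y 0) e}) :=
      Nat.sInf_mem (exists_isLeastColour L hXi hX)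
    obtain ⟨x, hx⟩ := hXi.nonempty
    refine ⟨_, greedySet_infinite (hmem.exists_gt L hXi hX hx), ?_⟩
    simp only [fst_pair, snd_pair]
    exact homogeneousWith_greedySet L hmem.2.2.1 x

theorem iART_le_iORT : ∃ k, ReducibleVia iART iORT orderedOfAdditive k := by
  refine ⟨fst, .orderedOfAdditive, .baire_fst, fun p _ => isOrderedInstance_orderedOfAdditive p, ?_⟩
  intro p hp y hy
  obtain ⟨X, hXi, ⟨F, hX⟩, a, ha, b, hb, hab, hby⟩ := hy
  rw [colour_orderedOfAdditive] at hX
  obtain ⟨Y, hYi, hY, a', ha', b', hb', hab', hle⟩ :=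
    exists_homogeneous_le (IsAdditiveInstance.laws hp) hXi hX ha hb hab
  rw [fst_pair]
  exact ⟨Y, hYi, hY, a', ha', b', hb', hab', hle.trans hby⟩

/-- The number `m` codes two elements `x < x'` of the set with characteristic function `fst q` and
an element `e` of the semigroup that is suitable for the colour of the pair `(x, x')`. -/
def IsSeed (q : Baire) (m : ℕ) : Prop :=
  fst q m.unpair.1 = 1 ∧ fst q m.unpair.2.unpair.1 = 1 ∧ m.unpair.1 < m.unpair.2.unpair.1 ∧
    IsLeastColour (size (snd q)) (table (snd q)) (factorColour (size (snd q)) (colour (snd q))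
      m.unpair.1 m.unpair.2.unpair.1) m.unpair.2.unpair.2

theorem ART_le_ORT : ∃ k, ReducibleVia ART ORT orderedOfAdditive k := by
  have mem_iff : ∀ (X : Set ℕ) n, X.indicator (1 : Baire) n = 1 ↔ n ∈ X := fun X n => by
    by_cases h : n ∈ X <;> simp [h]
  have hseed : ∀ p ∈ ART.dom, ∀ y ∈ ORT.sol (orderedOfAdditive p),
      ∃ m, IsSeed (pair y p) m := by
    rintro p hp _ ⟨X, hXi, ⟨F, hX⟩, rfl⟩
    rw [colour_orderedOfAdditive] at hX
    obtain ⟨e, he⟩ := exists_isLeastColour (IsAdditiveInstance.laws hp) hXi hX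
    obtain ⟨x, hx⟩ := hXi.nonempty
    obtain ⟨x', hx', hlt⟩ := hXi.exists_gt x
    refine ⟨Nat.pair x (Nat.pair x' e), ?_⟩
    simp only [IsSeed, Nat.unpair_pair, fst_pair, snd_pair, mem_iff]
    exact ⟨hx, hx', hlt, (hX x hx x' hx' hlt).symm ▸ he⟩
  have hgood : ∀ p ∈ ART.dom, ∀ y ∈ ORT.sol (orderedOfAdditive p), ∀ m, IsSeed (pair y p) m →
      table p m.unpair.2.unpair.2 m.unpair.2.unpair.2 = m.unpair.2.unpair.2 ∧
      ∀ T, ∃ y ≥ T, ∃ z > y, m.unpair.1 < y ∧ colour p m.unpair.1 y = m.unpair.2.unpair.2 ∧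
        colour p y z = m.unpair.2.unpair.2 := by
    rintro p hp _ ⟨X, hXi, ⟨F, hX⟩, rfl⟩ m hm
    rw [colour_orderedOfAdditive] at hX
    simp only [IsSeed, fst_pair, snd_pair, mem_iff] at hm
    obtain ⟨hx, hx', hlt, he⟩ := hm
    rw [hX _ hx _ hx' hlt] at he
    exact ⟨he.2.2.1, he.exists_gt (IsAdditiveInstance.laws hp) hXi hX hx⟩
  let m : Baire → ℕ := fun q => sInf {m | IsSeed q m}
  have hmem : ∀ q, (∃ m, IsSeed q m) → IsSeed q (m q) := fun q h => Nat.sInf_mem h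
  have hpair : ∀ q, pair (fst q) (snd q) = q := by
    intro q
    funext i
    rcases Nat.mod_two_eq_zero_or_one i with h | h
    · simp only [pair, h, fst, if_true]; congr 1; omega
    · simp only [pair, h, snd, if_false, one_ne_zero]; congr 1; omega
  have hm : OracleComputable {q | snd q ∈ ART.dom ∧ fst q ∈ ORT.sol (orderedOfAdditive (snd q))}
      fun q (_ : ℕ × ℕ) => m q := by
    refine .sInf (P := fun q _ m => IsSeed q m) ?_ fun q hq _ => ?_
    · have h1 := OracleComputable.id (α := (ℕ × ℕ) × ℕ)
        (D := {q | snd q ∈ ART.dom ∧ fst q ∈ ORT.sol (orderedOfAdditive (snd q))}) |>.snd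
      exact .and (.eq (.app .baire_fst h1.unpair_fst) (.const 1))
        (.and (.eq (.app .baire_fst h1.unpair_snd.unpair_fst) (.const 1))
        (.and (.lt h1.unpair_fst h1.unpair_snd.unpair_fst) (.isLeastColour .baire_snd
          (.factorColour .baire_snd h1.unpair_fst h1.unpair_snd.unpair_fst)
          h1.unpair_snd.unpair_snd)))
    · have h := hseed _ hq.1 _ hq.2
      rwa [hpair] at h
  refine ⟨fun q => (greedySet fun y z => (m q).unpair.1 < y ∧
    colour (snd q) (m q).unpair.1 y = (m q).unpair.2.unpair.2 ∧
    colour (snd q) y z = (m q).unpair.2.unpair.2).indicator 1,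
    .orderedOfAdditive, ?_, fun p _ => isOrderedInstance_orderedOfAdditive p, ?_⟩
  · refine .greedySet ?_ fun q hq => ?_
    · exact .and (.lt hm.unpair_fst (.fst .id)) (.and
        (.eq (.colour .baire_snd hm.unpair_fst (.fst .id)) hm.unpair_snd.unpair_snd)
        (.eq (.colour .baire_snd (.fst .id) (.snd .id)) hm.unpair_snd.unpair_snd))
    · have h := hgood _ hq.1 _ hq.2 (m q)
      rw [hpair] at h
      refine (h (hmem q ?_)).2
      have h' := hseed _ hq.1 _ hq.2
      rwa [hpair] at h'
  · intro p hp y hy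
    have h := hgood p hp y hy _ (hmem _ (hseed p hp y hy))
    simp only [snd_pair]
    exact ⟨_, greedySet_infinite h.2,
      ⟨_, homogeneousWith_greedySet (IsAdditiveInstance.laws hp) h.1 _⟩, rfl⟩

/-! ### Solving right-ordered instances -/

/-- The name of a list of `n` elements of Baire space, the `i`-th of them being `f i`. -/
def starName (n : ℕ) (f : ℕ → Baire) : Baire := cons n fun m => f m.unpair.1 m.unpair.2

theorem comp_tail_starName (n : ℕ) (f : ℕ → Baire) (i : ℕ) :
    comp (tail (starName n f)) i = f i := by
  funext s
  simp [comp, tail, starName, cons]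

theorem OracleComputable.starName {D : Set Baire} {n : Baire → ℕ} {f : Baire → ℕ → Baire}
    (hn : OracleComputable D fun p (_ : ℕ) => n p)
    (hf : OracleComputable D fun p (x : ℕ × ℕ) => f p x.1 x.2) :
    OracleComputable D fun p => starName (n p) (f p) :=
  hn.cons (app hf (map Computable.unpair id))

/-- The colour `a` is the colour of pairs `x < y` with `x` arbitrarily large. -/
def Recurrent (c : ℕ → ℕ → ℕ) (a : ℕ) : Prop := ∀ i, ∃ x ≥ i, ∃ y > x, c x y = a

/-- The colour `a` is maximal among the recurrent colours. -/
def IsMaxRecurrent (n : ℕ) (t c : ℕ → ℕ → ℕ) (a : ℕ) : Prop :=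
  a < n ∧ Recurrent c a ∧ ∀ b < n, Recurrent c b → t a b ≠ 0 → b = a

/-- Let `w = ⟨x₀, ⟨y₀, y₁⟩⟩` and `u = ⟨u₁, u₂⟩`. Then `x₀ < y₀ < y₁` with
`c x₀ y₀ = c y₀ y₁ = a`, and `(u₁, u₂)` is not a pair beyond `x₀` whose colour is strictly above
`a`. If this holds for all `u`, then a homogeneous set of colour `a` can start with `x₀`, `y₀`. -/
def Unrefuted (t c : ℕ → ℕ → ℕ) (a w u : ℕ) : Prop :=
  (w.unpair.1 < w.unpair.2.unpair.1 ∧ w.unpair.2.unpair.1 < w.unpair.2.unpair.2 ∧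
    c w.unpair.1 w.unpair.2.unpair.1 = a ∧ c w.unpair.2.unpair.1 w.unpair.2.unpair.2 = a) ∧
  (w.unpair.1 ≤ u.unpair.1 → u.unpair.1 < u.unpair.2 → t a (c u.unpair.1 u.unpair.2) ≠ 0 →
    c u.unpair.1 u.unpair.2 = a)

section
variable {n : ℕ} {t c : ℕ → ℕ → ℕ} {a w : ℕ}

theorem exists_isMaxRecurrent (L : OrderedLaws n t c) : ∃ a, IsMaxRecurrent n t c a := by
  classical
  obtain ⟨a, X, -, hXi, hX⟩ := exists_homogeneous_subset L.colour_lt Set.infinite_univ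
  have ha : Recurrent c a := fun i => by
    obtain ⟨x, hx, hix⟩ := hXi.exists_gt i
    obtain ⟨y, hy, hxy⟩ := hXi.exists_gt x
    exact ⟨x, hix.le, y, hxy, hX x hx y hy hxy⟩
  have hlt : ∀ b, Recurrent c b → b < n := fun b hb => by
    obtain ⟨x, -, y, hxy, rfl⟩ := hb 0
    exact L.colour_lt x y hxy
  -- a recurrent colour with as few colours above it as possible is maximal
  let up : ℕ → Finset ℕ := fun a => (Finset.range n).filter fun b => t a b ≠ 0
  have hup : ∀ {a b}, b ∈ up a ↔ b < n ∧ t a b ≠ 0 := by simp [up]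
  obtain ⟨m, hm, hmin⟩ := (measure fun a => (up a).card).wf.has_min {a | Recurrent c a} ⟨a, ha⟩
  refine ⟨m, hlt m hm, hm, fun b hb hbr hmb => by_contra fun hne => hmin b hbr ?_⟩
  refine Finset.card_lt_card ⟨fun d hd => ?_, fun hsub => hne ?_⟩
  · obtain ⟨hd, hbd⟩ := hup.1 hd
    exact hup.2 ⟨hd, L.trans m (hlt m hm) b hb d hd hmb hbd⟩
  · exact L.antisymm b hb m (hlt m hm) (hup.1 (hsub (hup.2 ⟨hlt m hm, L.refl m (hlt m hm)⟩))).2 hmb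

theorem IsMaxRecurrent.exists_unrefuted (L : OrderedLaws n t c) (h : IsMaxRecurrent n t c a) :
    ∃ w, ∀ u, Unrefuted t c a w u := by
  obtain ⟨ha, hrec, hmax⟩ := h
  have hev : ∀ᶠ x in atTop, ∀ b < n, t a b ≠ 0 → b ≠ a → ∀ y > x, c x y ≠ b := by
    refine (Filter.eventually_all_finite (Set.finite_lt_nat n)).2 fun b hb => ?_
    by_cases hb' : t a b ≠ 0 ∧ b ≠ a
    · have hnot : ¬ Recurrent c b := fun hr => hb'.2 (hmax b hb hr hb'.1)
      unfold Recurrent at hnot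
      push Not at hnot
      obtain ⟨i, hi⟩ := hnot
      filter_upwards [eventually_ge_atTop i] with x hx _ _ y hy
      exact hi x hx y hy
    · exact Eventually.of_forall fun x h1 h2 => absurd ⟨h1, h2⟩ hb'
  obtain ⟨N, hN⟩ := eventually_atTop.1 hev
  have hN' : ∀ x ≥ N, ∀ y > x, t a (c x y) ≠ 0 → c x y = a := fun x hx y hy h =>
    by_contra fun hne => hN x hx _ (L.colour_lt x y hy) h hne y hy rfl
  obtain ⟨x₀, hx₀, z, hz, e₀⟩ := hrec N
  obtain ⟨y₀, hy₀, y₁, hy₁, e₁⟩ := hrec z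
  have hxy : x₀ < y₀ := hz.trans_le hy₀
  have hle := L.mono x₀ z y₀ hz hy₀
  rw [e₀] at hle
  refine ⟨Nat.pair x₀ (Nat.pair y₀ y₁), fun u => ?_⟩
  simp only [Unrefuted, Nat.unpair_pair]
  exact ⟨⟨hxy, hy₁, hN' x₀ hx₀ y₀ hxy hle, e₁⟩, fun h1 h2 => hN' _ (hx₀.trans h1) _ h2⟩

theorem eq_of_unrefuted (L : OrderedLaws n t c) (hw : ∀ u, Unrefuted t c a w u) {y z y' : ℕ}
    (hy : w.unpair.1 ≤ y) (hyz : y < z) (hzy : z ≤ y') (h : c y z = a) : c y y' = a := by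
  have hu := (hw (Nat.pair y y')).2
  simp only [Nat.unpair_pair] at hu
  exact hu hy (hyz.trans_le hzy) (h ▸ L.mono y z y' hyz hzy)

theorem homogeneousWith_greedySet_of_unrefuted (L : OrderedLaws n t c)
    (hw : ∀ u, Unrefuted t c a w u) :
    HomogeneousWith c a (greedySet fun y z => w.unpair.1 ≤ y ∧ c y z = a) := by
  intro y hy y' hy' hlt
  obtain ⟨z, hyz, hzy, hwy, h⟩ := greedySet_spec hy hy' hlt
  exact eq_of_unrefuted L hw hwy hyz hzy h

theorem Recurrent.exists_ge (h : Recurrent c a) (N T : ℕ) :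
    ∃ y ≥ T, ∃ z > y, N ≤ y ∧ c y z = a := by
  obtain ⟨y, hy, z, hz, e⟩ := h (max N T)
  exact ⟨y, (le_max_right _ _).trans hy, z, hz, (le_max_left _ _).trans hy, e⟩

theorem exists_homogeneous_le_of_unrefuted (L : OrderedLaws n t c) (hrec : Recurrent c a)
    (hw : ∀ u, Unrefuted t c a w u) : ∃ Y : Set ℕ, Y.Infinite ∧ Homogeneous c Y ∧
      ∃ x ∈ Y, ∃ y ∈ Y, x < y ∧ y ≤ w := by
  obtain ⟨h01, h12, e01, e12⟩ := (hw 0).1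
  have hle : w.unpair.2.unpair.1 ≤ w :=
    (Nat.unpair_left_le _).trans (Nat.unpair_right_le _)
  have hG := homogeneousWith_greedySet_of_unrefuted L hw
  have hGi := greedySet_infinite (hrec.exists_ge w.unpair.1)
  refine ⟨{w.unpair.1, w.unpair.2.unpair.1} ∪
    (greedySet (fun y z => w.unpair.1 ≤ y ∧ c y z = a) \ Set.Iio w.unpair.2.unpair.2),
    (hGi.sdiff (Set.finite_Iio _)).mono Set.subset_union_right, ⟨a, ?_⟩, _, by simp, _,
    by simp, h01, hle⟩
  rintro u (hu | ⟨hu, hbu⟩) v (hv | ⟨hv, hbv⟩) huv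
  · rcases hu with rfl | hu <;> rcases hv with rfl | hv
    · omega
    · rw [Set.mem_singleton_iff.1 hv]; exact e01
    · rw [Set.mem_singleton_iff.1 hu] at huv; omega
    · rw [Set.mem_singleton_iff.1 hu, Set.mem_singleton_iff.1 hv] at huv; omega
  · have hbv' : w.unpair.2.unpair.2 ≤ v := not_lt.1 hbv
    rcases hu with rfl | hu
    · exact eq_of_unrefuted L hw le_rfl h01 (h12.le.trans hbv') e01
    · rw [Set.mem_singleton_iff.1 hu]
      exact eq_of_unrefuted L hw h01.le h12 hbv' e12
  · have hbu' : w.unpair.2.unpair.2 ≤ u := not_lt.1 hbu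
    rcases hv with rfl | hv
    · omega
    · rw [Set.mem_singleton_iff.1 hv] at huv; omega
  · exact hG u hu v hv huv

end

open scoped Classical in
/-- The enumeration of the numbers that are refuted as witnesses for the colour `a`. -/
noncomputable def refutations (p : Baire) (a : ℕ) : Baire := fun s =>
  if Unrefuted (table p) (colour p) a s.unpair.1 s.unpair.2 then 0 else s.unpair.1 + 1

open scoped Classical in
/-- The sequence of binary strings, the `i`-th of which changes from `1` to `0` as soon as a pair of
colour `a` beyond `i` is found. -/
noncomputable def recurrenceTest (p : Baire) (a : ℕ) : Baire := fun m =>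
  if ∃ y < m.unpair.2 + 1, ∃ x < y, m.unpair.1 ≤ x ∧ colour p x y = a then 0 else 1

/-- The instances of `TC_ℕ` and of `LPO'` for all colours of an ordered instance. -/
noncomputable def questions (p : Baire) : Baire :=
  pair (starName (size p) (refutations p)) (starName (size p) (recurrenceTest p))

theorem mem_enumerated_refutations {p : Baire} {a w : ℕ} :
    w ∈ enumerated (refutations p a) ↔ ¬ ∀ u, Unrefuted (table p) (colour p) a w u := by
  push Not
  constructor
  · rintro ⟨s, hs⟩
    unfold refutations at hs
    split_ifs at hs with h
    obtain rfl : s.unpair.1 = w := by omega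
    exact ⟨_, h⟩
  · rintro ⟨u, hu⟩
    refine ⟨Nat.pair w u, ?_⟩
    simp [refutations, hu]

theorem starTC_spec {p y : Baire} (hp : IsOrderedInstance p)
    (hy : y ∈ TC.star.sol (starName (size p) (refutations p))) {a : ℕ}
    (ha : IsMaxRecurrent (size p) (table p) (colour p) a) (u : ℕ) :
    Unrefuted (table p) (colour p) a (y (Nat.pair a 0 + 1)) u := by
  have h : comp (tail y) a ∈ TC.sol (comp (tail (starName (size p) (refutations p))) a) :=
    hy.2 a ha.1
  rw [comp_tail_starName] at h
  rcases h with h | h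
  · exact not_not.1 (mt mem_enumerated_refutations.2 h) u
  · obtain ⟨w, hw⟩ := ha.exists_unrefuted hp.laws
    exact absurd hw (mem_enumerated_refutations.1 (h ▸ Set.mem_univ w))

theorem recurrenceTest_le_one (p : Baire) (a m : ℕ) : recurrenceTest p a m ≤ 1 := by
  unfold recurrenceTest
  split_ifs <;> omega

open scoped Classical in
theorem isLimit_recurrenceTest (p : Baire) (a : ℕ) : IsLimit (recurrenceTest p a)
    fun i => if ∃ x ≥ i, ∃ y > x, colour p x y = a then 0 else 1 := by
  intro i
  simp only
  split_ifs with h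
  · obtain ⟨x, hx, y, hy, e⟩ := h
    filter_upwards [eventually_ge_atTop y] with s hs
    simp only [comp, recurrenceTest, Nat.unpair_pair]
    rw [if_pos ⟨y, by omega, x, hy, hx, e⟩]
  · refine Eventually.of_forall fun s => ?_
    simp only [comp, recurrenceTest, Nat.unpair_pair]
    rw [if_neg]
    rintro ⟨y, -, x, hxy, hx, e⟩
    exact h ⟨x, hx, y, hxy, e⟩

theorem IsLimit.unique {p r r' : Baire} (h : IsLimit p r) (h' : IsLimit p r') : r = r' := by
  funext i
  obtain ⟨s, h1, h2⟩ := ((h i).and (h' i)).exists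
  exact h1.symm.trans h2

theorem starLPOJump_spec {p y : Baire}
    (hy : y ∈ LPOJump.star.sol (starName (size p) (recurrenceTest p))) {a : ℕ} (ha : a < size p) :
    y (Nat.pair a 0 + 1) = 0 ↔ Recurrent (colour p) a := by
  classical
  have h : comp (tail y) a ∈ LPOJump.sol (comp (tail (starName (size p) (recurrenceTest p))) a) :=
    hy.2 a ha
  rw [comp_tail_starName] at h
  obtain ⟨r, hr, h⟩ := h
  obtain rfl := hr.unique (isLimit_recurrenceTest p a)
  change y (Nat.pair a 0 + 1) = 0 ∧ _ ∨ y (Nat.pair a 0 + 1) = 1 ∧ _ at h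
  rcases h with ⟨h0, h⟩ | ⟨h1, i, hi⟩
  · refine iff_of_true h0 fun i => ?_
    have h2 := h i
    simp only at h2
    split_ifs at h2 with h3
    exact h3
  · refine iff_of_false (by omega) fun hrec => ?_
    exact hi (if_pos (hrec i))

theorem starName_mem_dom_TC (n : ℕ) (f : ℕ → Baire) : starName n f ∈ TC.star.dom :=
  fun _ _ => Set.mem_univ _

theorem starName_mem_dom_LPOJump (p : Baire) :
    starName (size p) (recurrenceTest p) ∈ LPOJump.star.dom := by
  intro i _
  rw [comp_tail_starName]
  exact ⟨recurrenceTest_le_one p i, _, isLimit_recurrenceTest p i⟩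

/-- According to the answers `z` of `LPO'`, the colour `a` is maximal among the recurrent ones. -/
def AnsweredMax (p z : Baire) (a : ℕ) : Prop :=
  a < size p ∧ z (Nat.pair a 0 + 1) = 0 ∧
    ∀ b < size p, z (Nat.pair b 0 + 1) = 0 → table p a b ≠ 0 → b = a

theorem answeredMax_iff {p z : Baire}
    (hz : z ∈ LPOJump.star.sol (starName (size p) (recurrenceTest p))) {a : ℕ} :
    AnsweredMax p z a ↔ IsMaxRecurrent (size p) (table p) (colour p) a := by
  refine and_congr_right fun ha => and_congr (starLPOJump_spec hz ha) ?_
  exact forall₂_congr fun b hb => imp_congr (starLPOJump_spec hz hb) Iff.rfl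

section
variable {α : Type*} [Primcodable α] {D : Set Baire}

theorem OracleComputable.starName_refutations :
    OracleComputable D fun p => Weihrauch.starName (Weihrauch.size p) (refutations p) := by
  classical
  have hid : OracleComputable D fun p => p := query id
  refine starName (size hid) ?_
  have hw : OracleComputable D fun _ (x : ℕ × ℕ) => x.2.unpair.1 := id.snd.unpair_fst
  have hu : OracleComputable D fun _ (x : ℕ × ℕ) => x.2.unpair.2 := id.snd.unpair_snd
  refine ite (P := fun p (x : ℕ × ℕ) => Unrefuted (Weihrauch.table p) (Weihrauch.colour p) x.1
    x.2.unpair.1 x.2.unpair.2) ?_ (const 0) hw.succ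
  exact .and (.and (.lt hw.unpair_fst hw.unpair_snd.unpair_fst)
      (.and (.lt hw.unpair_snd.unpair_fst hw.unpair_snd.unpair_snd)
      (.and (.eq (.colour hid hw.unpair_fst hw.unpair_snd.unpair_fst) id.fst)
        (.eq (.colour hid hw.unpair_snd.unpair_fst hw.unpair_snd.unpair_snd) id.fst))))
    (.imp (.le hw.unpair_fst hu.unpair_fst) (.imp (.lt hu.unpair_fst hu.unpair_snd)
      (.imp (.not (.eq (.table hid id.fst (.colour hid hu.unpair_fst hu.unpair_snd)) (.const 0)))
        (.eq (.colour hid hu.unpair_fst hu.unpair_snd) id.fst))))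

theorem OracleComputable.starName_recurrenceTest :
    OracleComputable D fun p => Weihrauch.starName (Weihrauch.size p) (recurrenceTest p) := by
  classical
  have hid : OracleComputable D fun p => p := query id
  refine starName (size hid) (ite (P := fun p (x : ℕ × ℕ) => ∃ y < x.2.unpair.2 + 1, ∃ x' < y,
    x.2.unpair.1 ≤ x' ∧ Weihrauch.colour p x' y = x.1) ?_ (const 0) (const 1))
  exact .exists_lt id.snd.unpair_snd.succ (.exists_lt id.snd (.and
    (.le id.fst.fst.snd.unpair_fst id.snd) (.eq (colour hid id.snd id.fst.snd) id.fst.fst.fst)))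

theorem OracleDecidable.answeredMax {G Z : Baire → Baire} (hG : OracleComputable D G)
    (hZ : OracleComputable D Z) {f : Baire → α → ℕ} (hf : OracleComputable D f) :
    OracleDecidable D fun p a => AnsweredMax (G p) (Z p) (f p a) :=
  .and (.lt hf (.size hG)) (.and (.eq (.app hZ (hf.natPair (.const 0)).succ) (.const 0))
    (.forall_lt (.size hG) (.imp
      (.eq (.app hZ (OracleComputable.natPair (.snd .id) (.const 0)).succ) (.const 0))
      (.imp (.not (.eq (.table hG (OracleComputable.app hf (.fst .id)) (.snd .id)) (.const 0)))
        (.eq (.snd .id) (OracleComputable.app hf (.fst .id)))))))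

end

theorem cORT_le_LPOJump : ∃ h k, ReducibleVia cORT LPOJump.star h k := by
  have hex : ∀ p ∈ cORT.dom, ∀ z ∈ LPOJump.star.sol (starName (size p) (recurrenceTest p)),
      ∃ a, AnsweredMax p z a := fun p hp z hz => by
    obtain ⟨a, ha⟩ := exists_isMaxRecurrent (IsOrderedInstance.laws hp)
    exact ⟨a, (answeredMax_iff hz).2 ha⟩
  refine ⟨fun p => starName (size p) (recurrenceTest p),
    fun q _ => sInf {a | AnsweredMax (snd q) (fst q) a}, .starName_recurrenceTest,
    .sInf (.answeredMax .baire_snd .baire_fst (.snd .id)) fun q hq _ => hex _ hq.1 _ hq.2,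
    fun p _ => starName_mem_dom_LPOJump p, fun p hp z hz => ?_⟩
  have L := IsOrderedInstance.laws hp
  have ha : AnsweredMax p z (sInf {a | AnsweredMax p z a}) := Nat.sInf_mem (hex p hp z hz)
  have hmax := (answeredMax_iff hz).1 ha
  obtain ⟨w, hw⟩ := hmax.exists_unrefuted L
  refine ⟨_, greedySet_infinite (hmax.2.1.exists_ge w.unpair.1), ?_⟩
  simp only [fst_pair, snd_pair]
  exact homogeneousWith_greedySet_of_unrefuted L hw

theorem iORT_le_TC : ∃ h k, ReducibleVia iORT TC.star h k := by
  refine ⟨fun p => starName (size p) (refutations p),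
    fun q _ => ∑ a ∈ Finset.range (size (snd q)), fst q (Nat.pair a 0 + 1),
    .starName_refutations, ?_, fun p _ => starName_mem_dom_TC _ _, fun p hp y hy => ?_⟩
  · refine (OracleComputable.nat_rec (g := fun _ _ => 0)
      (h := fun q _ a s => s + fst q (Nat.pair a 0 + 1)) (.size .baire_snd) (.const 0)
      (.add (.snd (.snd .id)) (.app .baire_fst (OracleComputable.natPair (.fst (.snd .id))
        (.const 0)).succ))).congr fun q _ _ => ?_
    generalize size (snd q) = N
    induction N with
    | zero => rfl
    | succ N ih => rw [Finset.sum_range_succ, ← ih]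
  · have L := IsOrderedInstance.laws hp
    obtain ⟨a, ha⟩ := exists_isMaxRecurrent L
    obtain ⟨Y, hYi, hY, x, hx, x', hx', hlt, hle⟩ :=
      exists_homogeneous_le_of_unrefuted L ha.2.1 (starTC_spec hp hy ha)
    refine ⟨Y, hYi, hY, x, hx, x', hx', hlt, hle.trans ?_⟩
    simp only [fst_pair, snd_pair]
    exact Finset.single_le_sum (f := fun a => y (Nat.pair a 0 + 1)) (fun _ _ => Nat.zero_le _)
      (Finset.mem_range.2 ha.1)

theorem ORT_le_prod : ∃ h k, ReducibleVia ORT (TC.star.prod LPOJump.star) h k := by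
  let a : Baire → ℕ := fun q => sInf {a | AnsweredMax (snd q) (snd (fst q)) a}
  let x₀ : Baire → ℕ := fun q => (fst (fst q) (Nat.pair (a q) 0 + 1)).unpair.1
  have hsol : ∀ p, ∀ y ∈ (TC.star.prod LPOJump.star).sol (questions p),
      fst y ∈ TC.star.sol (starName (size p) (refutations p)) ∧
      snd y ∈ LPOJump.star.sol (starName (size p) (recurrenceTest p)) := by
    rintro p y ⟨h1, h2⟩
    rw [questions, fst_pair] at h1
    rw [questions, snd_pair] at h2
    exact ⟨h1, h2⟩
  have hex : ∀ p, IsOrderedInstance p → ∀ z ∈ LPOJump.star.sol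
      (starName (size p) (recurrenceTest p)), ∃ a, AnsweredMax p z a := fun p hp z hz => by
    obtain ⟨a, ha⟩ := exists_isMaxRecurrent hp.laws
    exact ⟨a, (answeredMax_iff hz).2 ha⟩
  have hmax : ∀ q, IsOrderedInstance (snd q) →
      fst q ∈ (TC.star.prod LPOJump.star).sol (questions (snd q)) →
      IsMaxRecurrent (size (snd q)) (table (snd q)) (colour (snd q)) (a q) := fun q hp hq =>
    (answeredMax_iff (hsol _ _ hq).2).1 (Nat.sInf_mem (hex _ hp _ (hsol _ _ hq).2))
  refine ⟨questions,
    fun q => (greedySet fun y z => x₀ q ≤ y ∧ colour (snd q) y z = a q).indicator 1,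
    OracleComputable.starName_refutations.pair .starName_recurrenceTest, ?_, fun p _ => ?_,
    fun p hp y hy => ?_⟩
  · refine .greedySet ?_ fun q hq => (hmax q hq.1 hq.2).2.1.exists_ge _
    have h1 : OracleComputable {q | snd q ∈ ORT.dom ∧
        fst q ∈ (TC.star.prod LPOJump.star).sol (questions (snd q))} fun q (_ : ℕ × ℕ) => a q := by
      refine .sInf (P := fun q _ a => AnsweredMax (snd q) (snd (fst q)) a)
        (.answeredMax .baire_snd (.snd_comp .baire_fst) (.snd .id)) ?_
      exact fun q hq _ => hex _ hq.1 _ (hsol _ _ hq.2).2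
    exact .and (.le (.unpair_fst (.app (.fst_comp .baire_fst)
        (h1.natPair (.const 0)).succ)) (.fst .id))
      (.eq (.colour .baire_snd (.fst .id) (.snd .id)) h1)
  · refine ⟨?_, ?_⟩
    · rw [questions, fst_pair]; exact starName_mem_dom_TC _ _
    · rw [questions, snd_pair]; exact starName_mem_dom_LPOJump _
  · have hm := hmax (pair y p)
    rw [fst_pair, snd_pair] at hm
    have hm := hm hp hy
    have hw := starTC_spec hp (hsol p y hy).1 hm
    refine ⟨_, greedySet_infinite (hm.2.1.exists_ge (x₀ (pair y p))), ⟨a (pair y p), ?_⟩, ?_⟩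
    · have := homogeneousWith_greedySet_of_unrefuted (IsOrderedInstance.laws hp) hw
      simpa only [x₀, fst_pair] using this
    · simp only [snd_pair]

/-! ### Encoding refutable guesses by additive colourings -/

open scoped Classical in
/-- The number guessed at stage `u` to be one that is never refuted, where `R w s` means that `w` is
refuted by `s`: the guess moves on to the next number whenever it is refuted by some `s < u`. -/
noncomputable def guess (R : ℕ → ℕ → Prop) : ℕ → ℕ
  | 0 => 0
  | u + 1 => if ∃ s < u, R (guess R u) s then guess R u + 1 else guess R u

/-- The guess changes after stage `u`. -/
def Change (R : ℕ → ℕ → Prop) (u : ℕ) : Prop := ∃ s < u, R (guess R u) s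

/-- All numbers are refuted. -/
def AllRefuted (R : ℕ → ℕ → Prop) : Prop := ∀ w, ∃ s, R w s

section
variable {R : ℕ → ℕ → Prop}

theorem guess_succ_of_change {u : ℕ} (h : Change R u) : guess R (u + 1) = guess R u + 1 := if_pos h

theorem guess_succ_of_not_change {u : ℕ} (h : ¬ Change R u) : guess R (u + 1) = guess R u :=
  if_neg h

theorem guess_eq_of_forall_not_change {x u : ℕ} (h : ∀ z ≥ x, ¬ Change R z) (hu : x ≤ u) :
    guess R u = guess R x := by
  induction u, hu using Nat.le_induction with
  | base => rfl
  | succ u hu ih => rw [guess_succ_of_not_change (h u hu), ih]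

theorem not_refuted_guess {x u : ℕ} (h : ∀ z ≥ x, ¬ Change R z) (hu : x ≤ u) (s : ℕ) :
    ¬ R (guess R u) s := by
  intro hs
  refine h (max x (s + 1)) (le_max_left _ _) ⟨s, by omega, ?_⟩
  rwa [guess_eq_of_forall_not_change h (le_max_left _ _), ← guess_eq_of_forall_not_change h hu]

theorem AllRefuted.exists_change (h : AllRefuted R) (N : ℕ) : ∃ z ≥ N, Change R z := by
  by_contra! hcon
  obtain ⟨s, hs⟩ := h (guess R N)
  exact not_refuted_guess hcon le_rfl s hs

theorem allRefuted_of_exists_change (h : ∀ N, ∃ z ≥ N, Change R z) : AllRefuted R := by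
  by_contra hcon
  unfold AllRefuted at hcon
  push Not at hcon
  obtain ⟨w, hw⟩ := hcon
  have hmono : Monotone (guess R) := monotone_nat_of_le_succ fun u => by
    by_cases hu : Change R u
    · rw [guess_succ_of_change hu]; omega
    · rw [guess_succ_of_not_change hu]
  have hle : ∀ u, guess R u ≤ w := by
    intro u
    induction u with
    | zero => exact Nat.zero_le _
    | succ u ih =>
      by_cases hu : Change R u
      · rw [guess_succ_of_change hu]
        refine Nat.succ_le_of_lt (ih.lt_of_ne fun e => ?_)
        obtain ⟨s, -, hs⟩ := hu
        exact hw s (e ▸ hs)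
      · rwa [guess_succ_of_not_change hu]
  have hunb : ∀ m, ∃ u, m ≤ guess R u := by
    intro m
    induction m with
    | zero => exact ⟨0, Nat.zero_le _⟩
    | succ m ih =>
      obtain ⟨u, hu⟩ := ih
      obtain ⟨z, hz, hc⟩ := h u
      exact ⟨z + 1, by rw [guess_succ_of_change hc]; exact Nat.succ_le_succ (hu.trans (hmono hz))⟩
  obtain ⟨u, hu⟩ := hunb (w + 1)
  exact absurd (hle u) (by omega)

end

/-- The table of the union of codes of subsets of `{0, …, K - 1}`. -/
noncomputable def unionTable (K i j : ℕ) : ℕ :=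
  bitmask (fun k => i.testBit k = true ∨ j.testBit k = true) K

/-- The code of the set of those `j < K` for which the guess changes between the stages `x`
and `y`. -/
noncomputable def changeColour (K : ℕ) (R : ℕ → ℕ → ℕ → Prop) (x y : ℕ) : ℕ :=
  bitmask (fun j => ∃ z < y, x ≤ z ∧ Change (R j) z) K

/-- The additive instance of the colouring `changeColour`. -/
noncomputable def changeInstance (K : ℕ) (R : ℕ → ℕ → ℕ → Prop) : Baire :=
  instanceName (2 ^ K) (unionTable K) (changeColour K R)

theorem bitmask_congr {P Q : ℕ → Prop} {N : ℕ} (h : ∀ i < N, P i ↔ Q i) :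
    bitmask P N = bitmask Q N :=
  Nat.eq_of_testBit_eq fun i => Bool.eq_iff_iff.2 <| by
    rw [testBit_bitmask, testBit_bitmask]
    exact and_congr_right (h i)

theorem additiveLaws_changeColour (K : ℕ) (R : ℕ → ℕ → ℕ → Prop) :
    AdditiveLaws (2 ^ K) (unionTable K) (changeColour K R) where
  table_lt _ _ _ _ := bitmask_lt _ _
  assoc i _ j _ k _ := bitmask_congr fun l hl => by
    simp only [unionTable, testBit_bitmask, hl, true_and, or_assoc]
  colour_lt _ _ _ := bitmask_lt _ _
  add x y z hxy hyz := bitmask_congr fun j hj => by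
    simp only [changeColour, testBit_bitmask, hj, true_and]
    constructor
    · rintro ⟨u, huz, hxu, h⟩
      rcases lt_or_ge u y with huy | huy
      · exact Or.inl ⟨u, huy, hxu, h⟩
      · exact Or.inr ⟨u, huz, huy, h⟩
    · rintro (⟨u, huy, hxu, h⟩ | ⟨u, huz, hyu, h⟩)
      · exact ⟨u, huy.trans hyz, hxu, h⟩
      · exact ⟨u, huz, hxy.le.trans hyu, h⟩

theorem isAdditiveInstance_changeInstance (K : ℕ) (R : ℕ → ℕ → ℕ → Prop) :
    IsAdditiveInstance (changeInstance K R) := (additiveLaws_changeColour K R).isAdditiveInstance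

theorem colour_changeInstance (K : ℕ) (R : ℕ → ℕ → ℕ → Prop) :
    colour (changeInstance K R) = changeColour K R := by
  funext x y
  exact colour_instanceName _ _ _ x y

section
variable {K : ℕ} {R : ℕ → ℕ → ℕ → Prop} {X : Set ℕ} {a j : ℕ}

theorem testBit_changeColour {x y : ℕ} (hj : j < K) :
    (changeColour K R x y).testBit j = true ↔ ∃ z < y, x ≤ z ∧ Change (R j) z := by
  rw [changeColour, testBit_bitmask]
  exact and_iff_right hj

theorem not_change_of_testBit (hXi : X.Infinite) (hX : HomogeneousWith (changeColour K R) a X)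
    (hj : j < K) (ha : ¬ a.testBit j = true) {x : ℕ} (hx : x ∈ X) :
    ∀ z ≥ x, ¬ Change (R j) z := by
  intro z hz hc
  obtain ⟨y, hy, hzy⟩ := hXi.exists_gt z
  rw [← hX x hx y hy (hz.trans_lt hzy), testBit_changeColour hj] at ha
  exact ha ⟨z, hzy, hz, hc⟩

/-- The colour of an infinite homogeneous set shows for which `j` all numbers are refuted. -/
theorem testBit_iff_allRefuted (hXi : X.Infinite) (hX : HomogeneousWith (changeColour K R) a X)
    (hj : j < K) : a.testBit j = true ↔ AllRefuted (R j) := by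
  constructor
  · refine fun ha => allRefuted_of_exists_change fun N => ?_
    obtain ⟨x, hx, hNx⟩ := hXi.exists_gt N
    obtain ⟨y, hy, hxy⟩ := hXi.exists_gt x
    rw [← hX x hx y hy hxy, testBit_changeColour hj] at ha
    obtain ⟨z, -, hxz, hc⟩ := ha
    exact ⟨z, hNx.le.trans hxz, hc⟩
  · refine fun h => by_contra fun ha => ?_
    obtain ⟨x, hx⟩ := hXi.nonempty
    obtain ⟨z, hz, hc⟩ := h.exists_change x
    exact not_change_of_testBit hXi hX hj ha hx z hz hc

/-- Beyond an element of an infinite homogeneous set the guesses are final. -/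
theorem allRefuted_or_not_refuted_guess (hXi : X.Infinite)
    (hX : HomogeneousWith (changeColour K R) a X) (hj : j < K) {x u : ℕ} (hx : x ∈ X)
    (hu : x ≤ u) : AllRefuted (R j) ∨ ∀ s, ¬ R j (guess (R j) u) s := by
  by_cases ha : a.testBit j = true
  · exact Or.inl ((testBit_iff_allRefuted hXi hX hj).1 ha)
  · exact Or.inr (not_refuted_guess (not_change_of_testBit hXi hX hj ha hx) hu)

end

/-- The `s`-th value of the enumeration `e` refutes the number `w` as a solution of `TC_ℕ`. -/
def TCRefutes (e : Baire) (w s : ℕ) : Prop := e s = w + 1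

/-- The number `w = ⟨i, v⟩`, read as the claim that `p_i(s) = 1` for all `s ≥ v`, is refuted
by `s`. -/
def LPORefutes (p : Baire) (w s : ℕ) : Prop := w.unpair.2 ≤ s ∧ comp p w.unpair.1 s = 0

theorem mem_sol_TC {e q : Baire}
    (h : AllRefuted (TCRefutes e) ∨ ∀ s, ¬ TCRefutes e (q 0) s) : q ∈ TC.sol e := by
  rcases h with h | h
  · exact Or.inr (Set.eq_univ_of_forall h)
  · exact Or.inl fun ⟨s, hs⟩ => h s hs

open scoped Classical in
theorem mem_sol_LPOJump {p q : Baire} (hp : p ∈ LPOJump.dom)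
    (h : q 0 = if AllRefuted (LPORefutes p) then 0 else 1) : q ∈ LPOJump.sol p := by
  obtain ⟨hp, r, hr⟩ := hp
  have hiff : AllRefuted (LPORefutes p) ↔ ∀ i, r i = 0 := by
    constructor
    · intro h i
      obtain ⟨v, hv⟩ := eventually_atTop.1 (hr i)
      obtain ⟨s, hs, hs'⟩ := h (Nat.pair i v)
      simp only [Nat.unpair_pair] at hs hs'
      rw [← hv s hs, hs']
    · intro h w
      obtain ⟨s, hs, hs'⟩ := ((hr w.unpair.1).and (eventually_ge_atTop w.unpair.2)).exists
      exact ⟨s, hs', hs.trans (h _)⟩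
  refine ⟨r, hr, ?_⟩
  split_ifs at h with h'
  · exact Or.inl ⟨h, hiff.1 h'⟩
  · exact Or.inr ⟨h, not_forall.1 (mt hiff.2 h')⟩

theorem starName_mem_sol {f : Problem} {p : Baire} {g : ℕ → Baire}
    (h : ∀ i < p 0, g i ∈ f.sol (comp (tail p) i)) : starName (p 0) g ∈ f.star.sol p :=
  ⟨rfl, fun i hi => by rw [comp_tail_starName]; exact h i hi⟩

section
variable {α : Type*} [Primcodable α] {D : Set Baire}

theorem OracleComputable.guess {R : Baire → ℕ → ℕ → ℕ → Prop}
    (hR : OracleDecidable D fun p (x : ℕ × ℕ × ℕ) => R p x.1 x.2.1 x.2.2) {f g : Baire → α → ℕ}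
    (hf : OracleComputable D f) (hg : OracleComputable D g) :
    OracleComputable D fun p a => guess (R p (f p a)) (g p a) := by
  classical
  refine (nat_rec (g := fun _ _ => 0) (h := fun p a u w => if ∃ s < u, R p (f p a) w s then w + 1
    else w) hg (const 0) (ite (.exists_lt id.snd.fst ?_) id.snd.snd.succ id.snd.snd)).congr
    fun p _ a => ?_
  · exact hR.app (.prodMk (app hf id.fst.fst) (.prodMk id.fst.snd.snd id.snd))
  · generalize g p a = u
    induction u with
    | zero => rfl
    | succ u ih => simp only [Weihrauch.guess, ← ih]

theorem OracleComputable.changeColour {K : Baire → ℕ} {R : Baire → ℕ → ℕ → ℕ → Prop}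
    (hK : OracleComputable D fun p (_ : α) => K p)
    (hR : OracleDecidable D fun p (x : ℕ × ℕ × ℕ) => R p x.1 x.2.1 x.2.2) {f g : Baire → α → ℕ}
    (hf : OracleComputable D f) (hg : OracleComputable D g) :
    OracleComputable D fun p a => changeColour (K p) (R p) (f p a) (g p a) := by
  refine bitmask hK (.exists_lt (app hg id.fst) (.and (.le (app hf id.fst.fst) id.snd)
    (.exists_lt id.snd ?_)))
  exact hR.app (.prodMk id.fst.fst.snd (.prodMk (guess hR id.fst.fst.snd id.fst.snd) id.snd))

theorem OracleComputable.changeInstance {K : Baire → ℕ} {R : Baire → ℕ → ℕ → ℕ → Prop}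
    (hK : OracleComputable D fun p (_ : ℕ) => K p)
    (hR : OracleDecidable D fun p (x : ℕ × ℕ × ℕ) => R p x.1 x.2.1 x.2.2) :
    OracleComputable D fun p => changeInstance (K p) (R p) := by
  have hK' : OracleComputable D fun p (_ : ℕ × ℕ) => K p :=
    app (f := fun p (_ : ℕ) => K p) hK (const 0)
  exact instanceName ((const 2).pow hK) (bitmask hK'
    (.or (.testBit id.fst.fst id.snd) (.testBit id.fst.snd id.snd)))
    (changeColour hK' hR id.fst id.snd)

theorem OracleDecidable.tcRefutes {G : Baire → Baire} (hG : OracleComputable D G)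
    {i w s : Baire → α → ℕ} (hi : OracleComputable D i) (hw : OracleComputable D w)
    (hs : OracleComputable D s) :
    OracleDecidable D fun p a => TCRefutes (comp (tail (G p)) (i p a)) (w p a) (s p a) :=
  .eq (.app (f := G) hG (hi.natPair hs).succ) hw.succ

theorem OracleDecidable.lpoRefutes {G : Baire → Baire} (hG : OracleComputable D G)
    {i w s : Baire → α → ℕ} (hi : OracleComputable D i) (hw : OracleComputable D w)
    (hs : OracleComputable D s) :
    OracleDecidable D fun p a => LPORefutes (comp (tail (G p)) (i p a)) (w p a) (s p a) :=
  .and (.le hw.unpair_snd hs)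
    (.eq (.app (f := G) hG (hi.natPair (hw.unpair_fst.natPair hs)).succ) (.const 0))

end

theorem TC_le_iART : ∃ h k, ReducibleVia TC.star iART h k := by
  let R : Baire → ℕ → ℕ → ℕ → Prop := fun p j => TCRefutes (comp (tail p) j)
  have hR : ∀ {D} {G : Baire → Baire}, OracleComputable D G →
      OracleDecidable D fun p (x : ℕ × ℕ × ℕ) => R (G p) x.1 x.2.1 x.2.2 := fun hG =>
    .tcRefutes hG (.fst .id) (.fst (.snd .id)) (.snd (.snd .id))
  refine ⟨fun p => changeInstance (p 0) (R p),
    fun q => starName (snd q 0) fun j _ => guess (R (snd q) j) (fst q 0),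
    .changeInstance (.query (.const 0)) (hR (.query .id)),
    .starName (.app .baire_snd (.const 0)) (.guess (hR .baire_snd) (.fst .id)
      (.app .baire_fst (.const 0))), fun p _ => isAdditiveInstance_changeInstance _ _,
    fun p _ y hy => ?_⟩
  obtain ⟨X, hXi, ⟨a, hX⟩, x, hx, x', hx', hlt, hle⟩ := hy
  rw [colour_changeInstance] at hX
  rw [fst_pair, snd_pair]
  exact starName_mem_sol fun j hj => mem_sol_TC
    (allRefuted_or_not_refuted_guess hXi hX hj hx (hlt.le.trans hle))

theorem LPOJump_le_cART : ∃ h k, ReducibleVia LPOJump.star cART h k := by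
  classical
  let R : Baire → ℕ → ℕ → ℕ → Prop := fun p j => LPORefutes (comp (tail p) j)
  refine ⟨fun p => changeInstance (p 0) (R p),
    fun q => starName (snd q 0) fun j _ => if (fst q 0).testBit j = true then 0 else 1,
    .changeInstance (.query (.const 0))
      (.lpoRefutes (.query .id) (.fst .id) (.fst (.snd .id)) (.snd (.snd .id))),
    .starName (.app .baire_snd (.const 0)) (.ite (.testBit (.app .baire_fst (.const 0)) (.fst .id))
      (.const 0) (.const 1)), fun p _ => isAdditiveInstance_changeInstance _ _,
    fun p hp y hy => ?_⟩
  obtain ⟨X, hXi, hX⟩ := hy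
  rw [colour_changeInstance] at hX
  rw [fst_pair, snd_pair]
  exact starName_mem_sol fun j hj => mem_sol_LPOJump (hp j hj)
    (if_congr (testBit_iff_allRefuted hXi hX hj) rfl rfl)

/-- The refutations of the guesses for an instance `p = ⟨t, l⟩` of `TC_ℕ^* × (LPO')^*`, those for
`t` coming first. -/
def ProdRefutes (p : Baire) (j w s : ℕ) : Prop :=
  (j < fst p 0 ∧ TCRefutes (comp (tail (fst p)) j) w s) ∨
    (fst p 0 ≤ j ∧ LPORefutes (comp (tail (snd p)) (j - fst p 0)) w s)

theorem prodRefutes_of_lt {p : Baire} {j : ℕ} (h : j < fst p 0) :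
    ProdRefutes p j = TCRefutes (comp (tail (fst p)) j) := by
  funext w s
  simp [ProdRefutes, h, not_le.2 h]

theorem prodRefutes_add (p : Baire) (j : ℕ) :
    ProdRefutes p (fst p 0 + j) = LPORefutes (comp (tail (snd p)) j) := by
  funext w s
  simp [ProdRefutes]

theorem OracleDecidable.prodRefutes {D : Set Baire} {G : Baire → Baire}
    (hG : OracleComputable D G) :
    OracleDecidable D fun p (x : ℕ × ℕ × ℕ) => ProdRefutes (G p) x.1 x.2.1 x.2.2 := by
  have h0 : OracleComputable D fun p (_ : ℕ × ℕ × ℕ) => fst (G p) 0 := .app hG.fst_comp (.const 0)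
  exact .or (.and (.lt (.fst .id) h0)
      (.tcRefutes hG.fst_comp (.fst .id) (.fst (.snd .id)) (.snd (.snd .id))))
    (.and (.le h0 (.fst .id))
      (.lpoRefutes hG.snd_comp (.sub (.fst .id) h0) (.fst (.snd .id)) (.snd (.snd .id))))

theorem prod_le_ART : ∃ h k, ReducibleVia (TC.star.prod LPOJump.star) ART h k := by
  classical
  let K : Baire → ℕ := fun p => fst p 0 + snd p 0
  -- two elements of the homogeneous set supplied by the solution of the instance of `ART_ℕ`
  let P : Baire → ℕ → Prop := fun y m =>
    y m.unpair.1 = 1 ∧ y m.unpair.2 = 1 ∧ m.unpair.1 < m.unpair.2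
  let x : Baire → ℕ := fun y => (sInf {m | P y m}).unpair.1
  let a : Baire → ℕ := fun q => changeColour (K (snd q)) (ProdRefutes (snd q)) (x (fst q))
    (sInf {m | P (fst q) m}).unpair.2
  have mem_iff : ∀ (X : Set ℕ) n, X.indicator (1 : Baire) n = 1 ↔ n ∈ X := fun X n => by
    by_cases h : n ∈ X <;> simp [h]
  have hex : ∀ p, ∀ y ∈ ART.sol p, ∃ m, P y m := by
    rintro p _ ⟨X, hXi, -, rfl⟩
    obtain ⟨x, hx⟩ := hXi.nonempty
    obtain ⟨x', hx', hlt⟩ := hXi.exists_gt x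
    refine ⟨Nat.pair x x', ?_⟩
    simp only [P, mem_iff, Nat.unpair_pair]
    exact ⟨hx, hx', hlt⟩
  refine ⟨fun p => changeInstance (K p) (ProdRefutes p),
    fun q => pair (starName (fst (snd q) 0) fun j _ => guess (ProdRefutes (snd q) j) (x (fst q)))
      (starName (snd (snd q) 0) fun j _ => if (a q).testBit (fst (snd q) 0 + j) = true then 0
        else 1), ?_, ?_, fun p _ => isAdditiveInstance_changeInstance _ _, fun p hp y hy => ?_⟩
  · exact .changeInstance (.add (.app .baire_fst (.const 0)) (.app .baire_snd (.const 0)))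
      (.prodRefutes (.query .id))
  · set D : Set Baire := {q | snd q ∈ (TC.star.prod LPOJump.star).dom ∧
      fst q ∈ ART.sol (changeInstance (K (snd q)) (ProdRefutes (snd q)))} with hD
    have hm : OracleComputable D fun q (_ : ℕ × ℕ) => sInf {m | P (fst q) m} := by
      refine .sInf (P := fun q _ m => P (fst q) m) ?_ fun q hq _ => hex _ _ hq.2
      have h1 : OracleComputable D fun _ (x : (ℕ × ℕ) × ℕ) => x.2 := .snd .id
      exact .and (.eq (.app .baire_fst h1.unpair_fst) (.const 1))
        (.and (.eq (.app .baire_fst h1.unpair_snd) (.const 1)) (.lt h1.unpair_fst h1.unpair_snd))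
    have hfst : ∀ {α : Type} [Primcodable α],
        OracleComputable D fun q (_ : α) => fst (snd q) 0 := .app (.fst_comp .baire_snd) (.const 0)
    have hsnd : ∀ {α : Type} [Primcodable α],
        OracleComputable D fun q (_ : α) => snd (snd q) 0 := .app (.snd_comp .baire_snd) (.const 0)
    have hR := OracleDecidable.prodRefutes (D := D) .baire_snd
    exact .pair (.starName hfst (.guess hR (.fst .id) hm.unpair_fst))
      (.starName hsnd (.ite (.testBit (.changeColour (K := fun q => K (snd q)) (.add hfst hsnd) hR
        hm.unpair_fst hm.unpair_snd) (.add hfst (.fst .id))) (.const 0) (.const 1)))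
  · have hP : P y (sInf {m | P y m}) := Nat.sInf_mem (hex _ y hy)
    obtain ⟨X, hXi, ⟨b, hX⟩, rfl⟩ := hy
    rw [colour_changeInstance] at hX
    simp only [P, mem_iff] at hP
    obtain ⟨hx, hx', hlt⟩ := hP
    have hab : a (pair (X.indicator 1) p) = b := by
      simp only [a, x, P, fst_pair, snd_pair, mem_iff]
      exact hX _ hx _ hx' hlt
    rw [hab, fst_pair, snd_pair]
    refine ⟨?_, ?_⟩
    · rw [fst_pair]
      refine starName_mem_sol fun j hj => mem_sol_TC ?_
      have h := allRefuted_or_not_refuted_guess hXi hX (j := j) (by simp only [K]; omega) hx le_rfl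
      simp only [x, P, mem_iff]
      rwa [prodRefutes_of_lt hj] at h ⊢
    · rw [snd_pair]
      refine starName_mem_sol fun j hj => mem_sol_LPOJump (hp.2 j hj) (if_congr ?_ rfl rfl)
      rw [← prodRefutes_add]
      exact testBit_iff_allRefuted hXi hX (by simp only [K]; omega)

end Weihrauch

theorem mainTheorem2 :
    (Weihrauch.Equivalent Weihrauch.ORT Weihrauch.ART ∧
      Weihrauch.Equivalent Weihrauch.ART
        (Weihrauch.Problem.prod (Weihrauch.Problem.star Weihrauch.TC)
          (Weihrauch.Problem.star Weihrauch.LPOJump))) ∧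
    (Weihrauch.Equivalent Weihrauch.cORT Weihrauch.cART ∧
      Weihrauch.Equivalent Weihrauch.cART (Weihrauch.Problem.star Weihrauch.LPOJump)) ∧
    (Weihrauch.Equivalent Weihrauch.iORT Weihrauch.iART ∧
      Weihrauch.Equivalent Weihrauch.iART (Weihrauch.Problem.star Weihrauch.TC)) := by
  obtain ⟨_, h₁⟩ := Weihrauch.ART_le_ORT
  obtain ⟨_, _, h₂⟩ := Weihrauch.ORT_le_prod
  obtain ⟨_, _, h₃⟩ := Weihrauch.prod_le_ART
  obtain ⟨_, c₁⟩ := Weihrauch.cART_le_cORT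
  obtain ⟨_, _, c₂⟩ := Weihrauch.cORT_le_LPOJump
  obtain ⟨_, _, c₃⟩ := Weihrauch.LPOJump_le_cART
  obtain ⟨_, i₁⟩ := Weihrauch.iART_le_iORT
  obtain ⟨_, _, i₂⟩ := Weihrauch.iORT_le_TC
  obtain ⟨_, _, i₃⟩ := Weihrauch.TC_le_iART
  exact ⟨⟨⟨(h₂.trans h₃).reducible, h₁.reducible⟩, (h₁.trans h₂).reducible, h₃.reducible⟩,
    ⟨⟨(c₂.trans c₃).reducible, c₁.reducible⟩, (c₁.trans c₂).reducible, c₃.reducible⟩,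
    ⟨(i₂.trans i₃).reducible, i₁.reducible⟩, (i₁.trans i₂).reducible, i₃.reducible⟩
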